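/- **Setting.** Fix $\theta,L,B>0$, $k\in(0,1)$ and an integer $D\ge 0$. For $m>0$ let $\mathrm{NB}(\theta,m)$ be the law on $\{0,1,2,\dots\}$ with mass function $f(y;\theta,m)=\frac{\Gamma(\theta+y)}{\Gamma(\theta)\,y!}\big(\frac{m}{\theta+m}\big)^y\big(\frac{\theta}{\theta+m}\big)^\theta$. For $n,p\ge 1$ let $(X_1,Y_1),\dots,(X_n,Y_n)$ be independent, with $X_i$ a random vector in $\mathbb R^p$ and, conditionally on $X_i$, $Y_i\sim \mathrm{NB}(\theta,e^{X_i^T\beta^*})$, where $\beta^*\in\mathbb R^p$ is the true coefficient vector, $H=\{j:\beta^*_j\ne0\}$ and $d^*=|H|\le D$. (The rows $X_i$ need not be identically distributed; an i.i.d. design and a deterministic design are both included.) Assume: * almost surely $|X_{ij}|\le L$ for all $i,j$; $\|\beta^*\|_\infty\le B$; and almost surely $|X_i^T\beta^*|\le LB$ for all $i$ (for instance $\|\beta^*\|_1\le B$); * Stabil condition $S(3.5,\varepsilon_n,k)$ with $\varepsilon_n\ge 0$: with $\Sigma=\frac1n\sum_{i=1}^n\mathrm E(X_iX_i^T)$ (which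 is $\mathrm E(XX^T)$ for i.i.d. rows), $b^T\Sigma b\ge k\sum_{j\in H}b_j^2-\varepsilon_n$ for every $b\in\mathbb R^p$ with $\sum_{j\notin H}|b_j|\le 3.5\sum_{j\in H}|b_j|+\varepsilon_n$; * $A>1$, $M=16B+2\varepsilon_n$, and $C$ is a constant with $\mathrm E Z^q\le q!\,C^q$ for all integers $q\ge1$ and all $Z\sim \mathrm{NB}(\theta,e^t)$, $|t|\le LB$; * $\lambda_1\ge\max\Big\{32A^2LC\,\frac{\log 2p}{n},\ 16\sqrt2\,ALC\sqrt{\frac{\log 2p}{n}},\ \frac{20\theta AML}{M+\varepsilon_n}\sqrt{\frac{2\log 2p}{n}}\Big\}$ and $\lambda_2=\frac{\lambda_1}{8B}$. The elastic-net estimate $\hat\beta$ minimizes over $\beta\in\mathbb R^p$ $$-\frac1n\sum_{i=1}^n\big[Y_iX_i^T\beta-(\theta+Y_i)\log(\theta+e^{X_i^T\beta})\big]+\lambda_1\|\beta\|_1+\lambda_2\|\beta\|_2^2 .$$ Put $K=\max_{i,j}|X_{ij}|$, $\rho_{kl}=\frac1n\sum_{i}X_{ik}X_{il}$ for coordinates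 $k,l\in\{1,\dots,p\}$, and $$\mu=\frac{e^{LB}(\theta+e^{LB})}{\theta},\qquad \sigma^2=\Big(2+\frac6\theta\Big)\mu^2+\mu .$$ Let $\mathcal S$ be the event that the predictors are standardized: $\frac1n\sum_iX_{ij}^2=1$ and $\frac1n\sum_iX_{ij}=0$ for $j=1,\dots,p$. **Theorem (grouping effect oracle inequality).** There is a constant $C_0\ge0$ that depends only on $\theta,L,B,k,D$ (the $O(1)$ below) such that the following hold. (i) Under the above assumptions, for every $E>0$, with probability at least $1-2(2p)^{1-A^2}-(2p)^{-A^2}-\frac{\sigma^2}{nE^2}$ the following is true: if $\mathcal S$ occurs, then for all $k,l\in\{1,\dots,p\}$ $$|\hat\beta_k-\hat\beta_l|^2\le\tfrac12(1-\rho_{kl})\Big[Ke^{2LM}C_0+\frac1{\lambda_2^2}(E+\mu)\Big].$$ (In particular, if the predictors are standardized almost surely, the inequality itself holds with at least this probability.) (ii) Consider a sequence of such models, with the same $\theta,L,B,k,D,A,C$, with $n\to\infty$, $p=p_n\to\infty$, $\lambda_2^2=O(\frac{\log p}{n})$ and $\frac{\log p}n\to0$, and with coordinates $k=k_n$, $l=l_n$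 such that $\rho_{kl}=1-o_p(\lambda_2^2)$ on $\mathcal S$, that is, $P\big(\mathcal S\cap\{|R_n|>\delta\}\big)\to0$ for every $\delta>0$, where $R_n=(1-\rho_{kl})/\lambda_2^2$. Then for every $E>0$, with probability at least $1-2(2p)^{1-A^2}-(2p)^{-A^2}-\frac{\sigma^2}{nE^2}$, if $\mathcal S$ occurs then $$|\hat\beta_k-\hat\beta_l|\le\sqrt{\tfrac12R_n\big[\lambda_2^2e^{2LM}C_0+(E+\mu)\big]},$$ and $|\hat\beta_k-\hat\beta_l|\to0$ in probability on $\mathcal S$, i.e. $P\big(\mathcal S\cap\{|\hat\beta_k-\hat\beta_l|>\delta\}\big)\to0$ for every $\delta>0$. -/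

import Mathlib

open MeasureTheory ProbabilityTheory Filter Topology Asymptotics
open scoped BigOperators Matrix

universe u

noncomputable section

/-- Probability mass at `y` of the negative binomial law with dispersion `θ` and mean `m`. -/
def nbPMF (θ m : ℝ) (y : ℕ) : ℝ :=
  Real.Gamma (θ + y) / (Real.Gamma θ * (y.factorial : ℝ)) *
    (m / (θ + m)) ^ y * (θ / (θ + m)) ^ θ

/-- `C` bounds the moments of all negative binomial laws whose linear predictor lies in
`[-R, R]`: one has `E Z ^ q ≤ q! C ^ q` for every `q ≥ 1` (the moments being finite). -/
def IsMomentConstant (θ R C : ℝ) : Prop :=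
  ∀ t : ℝ, |t| ≤ R → ∀ q : ℕ, 1 ≤ q →
    Summable (fun y : ℕ => (y : ℝ) ^ q * nbPMF θ (Real.exp t) y) ∧
    ∑' y : ℕ, (y : ℝ) ^ q * nbPMF θ (Real.exp t) y ≤ (q.factorial : ℝ) * C ^ q

/-- Average negative log-likelihood of negative binomial regression with design rows `x i` and
counts `y i` (up to a term that does not depend on the coefficient vector `b`). -/
def nbLoss {n p : ℕ} (θ : ℝ) (x : Fin n → Fin p → ℝ) (y : Fin n → ℕ) (b : Fin p → ℝ) : ℝ :=
  -(1 / (n : ℝ)) * ∑ i, ((y i : ℝ) * (x i ⬝ᵥ b)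
    - (θ + (y i : ℝ)) * Real.log (θ + Real.exp (x i ⬝ᵥ b)))

/-- The elastic-net objective. -/
def enObjective {n p : ℕ} (θ lam1 lam2 : ℝ) (x : Fin n → Fin p → ℝ) (y : Fin n → ℕ)
    (b : Fin p → ℝ) : ℝ :=
  nbLoss θ x y b + lam1 * ∑ j, |b j| + lam2 * ∑ j, b j ^ 2

/-- `b` is the elastic-net estimate: it minimizes the objective over all of `ℝ^p`. -/
def IsElasticNet {n p : ℕ} (θ lam1 lam2 : ℝ) (x : Fin n → Fin p → ℝ) (y : Fin n → ℕ)
    (b : Fin p → ℝ) : Prop :=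
  IsMinOn (enObjective θ lam1 lam2 x y) Set.univ b

/-- The support `H` of a coefficient vector. -/
def coefSupport {p : ℕ} (b : Fin p → ℝ) : Finset (Fin p) :=
  Finset.univ.filter (fun j => b j ≠ 0)

/-- The fluctuated cone `V(c, ε) = {b : ‖b_{Hᶜ}‖₁ ≤ c ‖b_H‖₁ + ε}`. -/
def fluctCone {p : ℕ} (H : Finset (Fin p)) (c ε : ℝ) : Set (Fin p → ℝ) :=
  {b | ∑ j ∈ Hᶜ, |b j| ≤ c * ∑ j ∈ H, |b j| + ε}

/-- The Stabil condition `S(c, ε, k)` for the matrix `S` and the index set `H`. -/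
def StabilCondition {p : ℕ} (H : Finset (Fin p)) (S : Matrix (Fin p) (Fin p) ℝ)
    (c ε k : ℝ) : Prop :=
  0 < k ∧ k < 1 ∧
    ∀ b ∈ fluctCone H c ε, k * ∑ j ∈ H, b j ^ 2 - ε ≤ b ⬝ᵥ (S *ᵥ b)

/-- The population matrix `(1/n) ∑ᵢ E (Xᵢ Xᵢᵀ)`. For identically distributed rows it is
`E (X Xᵀ)`, for a deterministic design it is the Gram matrix. -/
def popGram {Ω : Type u} [MeasurableSpace Ω] (P : Measure Ω) {n p : ℕ}
    (X : Fin n → Ω → Fin p → ℝ) : Matrix (Fin p) (Fin p) ℝ :=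
  Matrix.of fun j l => (1 / (n : ℝ)) * ∑ i, ∫ ω, X i ω j * X i ω l ∂P

/-- The constant `M = 16 B + 2 ε`. -/
def radiusM (B ε : ℝ) : ℝ := 16 * B + 2 * ε

/-- The lower bound `max (G₁, G₂, G₃)` for the tuning parameter `λ₁`. -/
def tuningBound (θ L B A C ε : ℝ) (n p : ℕ) : ℝ :=
  max (32 * A ^ 2 * L * C * (Real.log (2 * (p : ℝ)) / (n : ℝ)))
    (max (16 * √2 * A * L * C * √(Real.log (2 * (p : ℝ)) / (n : ℝ)))
      (20 * θ * A * radiusM B ε * L / (radiusM B ε + ε) *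
        √(2 * Real.log (2 * (p : ℝ)) / (n : ℝ))))

/-- The negative binomial regression model with independent observations `(Xᵢ, Yᵢ)`, together
with the assumptions on the design, the true coefficient vector `βs` and the tuning
parameters. -/
structure OracleHypotheses {Ω : Type u} [MeasurableSpace Ω] (P : Measure Ω) {n p : ℕ}
    (X : Fin n → Ω → Fin p → ℝ) (Y : Fin n → Ω → ℕ) (βs : Fin p → ℝ)
    (θ L B k A C ε lam1 lam2 : ℝ) : Prop where
  isProb : IsProbabilityMeasure P
  n_pos : 0 < n
  p_pos : 0 < p
  measurable_X : ∀ i, Measurable (X i)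
  measurable_Y : ∀ i, Measurable (Y i)
  indep : iIndepFun (fun i ω => (X i ω, Y i ω)) P
  /-- Given `Xᵢ`, the response `Yᵢ` is negative binomial with mean `exp (Xᵢᵀ βs)`. -/
  condLaw : ∀ i (y : ℕ),
    P⟦Y i ⁻¹' {y} | MeasurableSpace.comap (X i) inferInstance⟧
      =ᵐ[P] fun ω => nbPMF θ (Real.exp (X i ω ⬝ᵥ βs)) y
  bounded_X : ∀ i, ∀ᵐ ω ∂P, ∀ j, |X i ω j| ≤ L
  bounded_beta : ∀ j, |βs j| ≤ B
  bounded_predictor : ∀ i, ∀ᵐ ω ∂P, |X i ω ⬝ᵥ βs| ≤ L * B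
  eps_nonneg : 0 ≤ ε
  stabil : StabilCondition (coefSupport βs) (popGram P X) 3.5 ε k
  one_lt_A : 1 < A
  momentConstant : IsMomentConstant θ (L * B) C
  lam1_ge : tuningBound θ L B A C ε n p ≤ lam1
  lam2_eq : lam2 = lam1 / (8 * B)

/-- Every predictor has empirical second moment `1` and empirical mean `0`. -/
def Standardized {n p : ℕ} (x : Fin n → Fin p → ℝ) : Prop :=
  ∀ j, (1 / (n : ℝ)) * ∑ i, x i j ^ 2 = 1 ∧ (1 / (n : ℝ)) * ∑ i, x i j = 0

/-- The empirical correlation coefficient `ρ_{kl}` of standardized predictors. -/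
def empCorr {n p : ℕ} (x : Fin n → Fin p → ℝ) (k l : Fin p) : ℝ :=
  (1 / (n : ℝ)) * ∑ i, x i k * x i l

/-- `K = max |x_{ij}|`. -/
def maxEntry {n p : ℕ} (x : Fin n → Fin p → ℝ) : ℝ := ⨆ i, ⨆ j, |x i j|

/-- The bound `μ` for the variances of the responses. -/
def varBound (θ L B : ℝ) : ℝ :=
  Real.exp (L * B) * (θ + Real.exp (L * B)) / θ

/-- The bound `σ²` for the variances of the squared centred responses. -/
def sqVarBound (θ L B : ℝ) : ℝ :=
  (2 + 6 / θ) * varBound θ L B ^ 2 + varBound θ L B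

/-- The failure probability `2 (2p)^{1-A²} + (2p)^{-A²} + σ² / (n E²)`. -/
def failureProb (θ L B A E : ℝ) (n p : ℕ) : ℝ :=
  2 * (2 * (p : ℝ)) ^ (1 - A ^ 2) + (2 * (p : ℝ)) ^ (-A ^ 2)
    + sqVarBound θ L B / ((n : ℝ) * E ^ 2)

end

/-!
The vector obtained from `β̂` by exchanging the coordinates `k` and `l` has the same `ℓ¹` norm, so
the first-order condition for `β̂` in its direction involves only the loss and the ridge penalty.
With the Cauchy–Schwarz inequality it bounds `|β̂_k - β̂_l|²` by `(1 - ρ_kl) / (2 λ₂²)` times the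
mean squared score at `β̂`.

By Bernstein's inequality every coordinate of the gradient of the loss at `β*` is, with high
probability, at most `λ₁ / 2` in absolute value. Comparing the objective at `β̂` and at `β*`
then bounds `‖β̂‖₁` by a multiple of `‖β*‖₁ ≤ D B`. All linear predictors therefore lie in a fixed
interval, where the loss is strongly convex, and the same comparison bounds the mean squared
prediction error by a multiple of `λ₁ = 8 B λ₂`.

On that interval scores are smaller than residuals by a fixed factor `s < 1`, and by Chebyshev's
inequality the mean squared residual at `β*` is at most `E + μ`. The spare amount `(1 - s) μ`
absorbs the error of order `λ₂` up to a multiple of `λ₂²`, by the arithmetic-geometric mean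
inequality.
-/

/-- The contribution of one observation to the negative log-likelihood, as a function of the
linear predictor `η`. -/
noncomputable def nbNegLog (θ y η : ℝ) : ℝ :=
  -(y * η - (θ + y) * Real.log (θ + Real.exp η))

/-- The score of one observation: minus the derivative of `nbNegLog` in `η`. -/
noncomputable def nbScore (θ y η : ℝ) : ℝ :=
  θ * (y - Real.exp η) / (θ + Real.exp η)

/-- A lower bound for the second derivative of `nbNegLog` on `[-R, R]`. -/
noncomputable def nbCurv (θ R : ℝ) : ℝ :=
  θ ^ 2 * Real.exp (-R) / (θ + Real.exp R) ^ 2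

/-- The factor `θ / (θ + e^{-R}) < 1` by which scores on `[-R, R]` are smaller than residuals. -/
noncomputable def nbShrink (θ R : ℝ) : ℝ :=
  θ / (θ + Real.exp (-R))

section Loss

variable {θ y a b R : ℝ}

theorem nbLoss_eq_sum {n p : ℕ} (θ : ℝ) (x : Fin n → Fin p → ℝ) (y : Fin n → ℕ)
    (b : Fin p → ℝ) :
    nbLoss θ x y b = (1 / (n : ℝ)) * ∑ i, nbNegLog θ (y i) (x i ⬝ᵥ b) := by
  simp only [nbLoss, nbNegLog, Finset.sum_neg_distrib]
  ring

theorem hasDerivAt_nbNegLog (hθ : 0 < θ) (y η : ℝ) :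
    HasDerivAt (nbNegLog θ y) (-nbScore θ y η) η := by
  have hpos : θ + Real.exp η ≠ 0 := by positivity
  refine (((hasDerivAt_id η).const_mul y).sub
    ((((Real.hasDerivAt_exp η).const_add θ).log hpos).const_mul (θ + y))).neg.congr_deriv ?_
  simp only [nbScore]
  field_simp
  ring

theorem hasDerivAt_neg_nbScore (hθ : 0 < θ) (y η : ℝ) :
    HasDerivAt (fun η => -nbScore θ y η)
      (θ * (θ + y) * Real.exp η / (θ + Real.exp η) ^ 2) η := by
  have hpos : θ + Real.exp η ≠ 0 := by positivity
  refine ((((Real.hasDerivAt_exp η).const_sub y).const_mul θ).div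
    ((Real.hasDerivAt_exp η).const_add θ) hpos).neg.congr_deriv ?_
  field_simp
  ring

theorem nbCurv_pos (hθ : 0 < θ) (R : ℝ) : 0 < nbCurv θ R := by
  unfold nbCurv
  positivity

theorem nbCurv_le (hθ : 0 < θ) (hy : 0 ≤ y) {η : ℝ} (hη : η ∈ Set.Icc (-R) R) :
    nbCurv θ R ≤ θ * (θ + y) * Real.exp η / (θ + Real.exp η) ^ 2 := by
  rw [nbCurv, sq θ]
  gcongr
  · linarith
  · exact hη.1
  · exact hη.2

/-- Subtracting `c / 2 * (t - a) ^ 2` leaves a convex function, which lies above its tangent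
at `a`. -/
theorem quadratic_le_of_le_deriv2 {f f' f'' : ℝ → ℝ} {c : ℝ} {S : Set ℝ} (hS : Convex ℝ S)
    (hf : ∀ t, HasDerivAt f (f' t) t) (hf' : ∀ t, HasDerivAt f' (f'' t) t)
    (hc : ∀ t ∈ S, c ≤ f'' t) (ha : a ∈ S) (hb : b ∈ S) :
    f a + f' a * (b - a) + c / 2 * (b - a) ^ 2 ≤ f b := by
  have hg : ∀ t, HasDerivAt (fun t => f t - c / 2 * (t - a) ^ 2) (f' t - c * (t - a)) t := by
    intro t
    refine ((hf t).sub ((((hasDerivAt_id t).sub_const a).pow 2).const_mul (c / 2))).congr_deriv ?_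
    simp only [id_eq, Nat.cast_ofNat]
    ring
  have hg' : ∀ t, HasDerivAt (fun t => f' t - c * (t - a)) (f'' t - c) t := fun t =>
    ((hf' t).sub (((hasDerivAt_id t).sub_const a).const_mul c)).congr_deriv (by rw [mul_one])
  have hconv : ConvexOn ℝ S (fun t => f t - c / 2 * (t - a) ^ 2) :=
    convexOn_of_hasDerivWithinAt2_nonneg hS
      (fun t _ => (hg t).continuousAt.continuousWithinAt)
      (fun t _ => (hg t).hasDerivWithinAt) (fun t _ => (hg' t).hasDerivWithinAt)
      (fun t ht => sub_nonneg.mpr (hc t (interior_subset ht)))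
  rcases lt_trichotomy a b with hab | rfl | hab
  · have h := hconv.le_slope_of_hasDerivAt ha hb hab (hg a)
    rw [slope_def_field, le_div_iff₀ (sub_pos.mpr hab)] at h
    linarith
  · simp
  · have h := hconv.slope_le_of_hasDerivAt hb ha hab (hg a)
    rw [slope_def_field, div_le_iff₀ (sub_pos.mpr hab)] at h
    linarith

theorem nbNegLog_quadratic_lower (hθ : 0 < θ) (hy : 0 ≤ y) (ha : |a| ≤ R) (hb : |b| ≤ R) :
    nbNegLog θ y a - nbScore θ y a * (b - a) + nbCurv θ R / 2 * (b - a) ^ 2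
      ≤ nbNegLog θ y b := by
  have h := quadratic_le_of_le_deriv2 (convex_Icc (-R) R) (hasDerivAt_nbNegLog hθ y)
    (hasDerivAt_neg_nbScore hθ y) (fun _ => nbCurv_le hθ hy) (abs_le.mp ha) (abs_le.mp hb)
  linarith

theorem abs_exp_sub_exp_le (ha : a ≤ R) (hb : b ≤ R) :
    |Real.exp a - Real.exp b| ≤ Real.exp R * |a - b| :=
  (convex_Iic R).norm_image_sub_le_of_norm_hasDerivWithin_le
    (fun t _ => (Real.hasDerivAt_exp t).hasDerivWithinAt)
    (fun t ht => by simpa using ht) hb ha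

theorem nbShrink_pos (hθ : 0 < θ) (R : ℝ) : 0 < nbShrink θ R := by
  unfold nbShrink
  positivity

theorem nbShrink_lt_one (hθ : 0 < θ) (R : ℝ) : nbShrink θ R < 1 := by
  unfold nbShrink
  rw [div_lt_one (by positivity)]
  linarith [Real.exp_pos (-R)]

theorem sq_mul_add_sq_le {s : ℝ} (hs : 0 ≤ s) (hs1 : s < 1) (u v : ℝ) :
    s ^ 2 * (u + v) ^ 2 ≤ s * u ^ 2 + v ^ 2 / (1 - s) := by
  have h1s : 0 < 1 - s := sub_pos.mpr hs1
  have hsq : s * u ^ 2 + v ^ 2 / (1 - s) - s ^ 2 * (u + v) ^ 2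
      = s * ((1 - s) * u - s * v) ^ 2 / (1 - s) + (1 + s) * v ^ 2 := by
    field_simp
    ring
  have : 0 ≤ s * ((1 - s) * u - s * v) ^ 2 / (1 - s) + (1 + s) * v ^ 2 := by positivity
  linarith

theorem nbScore_sq_le (hθ : 0 < θ) (ha : |a| ≤ R) (hb : |b| ≤ R) :
    nbScore θ y b ^ 2 ≤ nbShrink θ R * (y - Real.exp a) ^ 2
      + Real.exp R ^ 2 / (1 - nbShrink θ R) * (b - a) ^ 2 := by
  have hs1 : 0 < 1 - nbShrink θ R := sub_pos.mpr (nbShrink_lt_one hθ R)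
  rw [abs_le] at ha hb
  have hshrink : θ / (θ + Real.exp b) ≤ nbShrink θ R := by
    unfold nbShrink
    gcongr
    exact hb.1
  have hexp : (Real.exp a - Real.exp b) ^ 2 ≤ (Real.exp R * (b - a)) ^ 2 := by
    rw [sq_le_sq, abs_mul, Real.abs_exp, abs_sub_comm b a]
    exact abs_exp_sub_exp_le ha.2 hb.2
  calc nbScore θ y b ^ 2 = (θ / (θ + Real.exp b)) ^ 2 * (y - Real.exp b) ^ 2 := by
        rw [nbScore, mul_div_right_comm, mul_pow]
    _ ≤ nbShrink θ R ^ 2 * ((y - Real.exp a) + (Real.exp a - Real.exp b)) ^ 2 := by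
        rw [sub_add_sub_cancel]
        gcongr
    _ ≤ nbShrink θ R * (y - Real.exp a) ^ 2
          + (Real.exp a - Real.exp b) ^ 2 / (1 - nbShrink θ R) :=
        sq_mul_add_sq_le (nbShrink_pos hθ R).le (nbShrink_lt_one hθ R) _ _
    _ ≤ nbShrink θ R * (y - Real.exp a) ^ 2
          + (Real.exp R * (b - a)) ^ 2 / (1 - nbShrink θ R) := by gcongr
    _ = _ := by ring

end Loss

section Design

variable {n p : ℕ} {x : Fin n → Fin p → ℝ} {y : Fin n → ℕ} {b b' : Fin p → ℝ}

theorem sum_sq_sub_eq_of_standardized (hx : Standardized x) (k l : Fin p) :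
    (1 / (n : ℝ)) * ∑ i, (x i k - x i l) ^ 2 = 2 * (1 - empCorr x k l) := by
  have hexpand : ∑ i, (x i k - x i l) ^ 2
      = ∑ i, x i k ^ 2 + ∑ i, x i l ^ 2 - 2 * ∑ i, x i k * x i l := by
    rw [Finset.mul_sum, ← Finset.sum_add_distrib, ← Finset.sum_sub_distrib]
    exact Finset.sum_congr rfl fun i _ => by ring
  rw [hexpand, empCorr]
  linear_combination (hx k).1 + (hx l).1

theorem one_sub_empCorr_nonneg (hx : Standardized x) (k l : Fin p) : 0 ≤ 1 - empCorr x k l := by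
  have hsq : 0 ≤ (1 / (n : ℝ)) * ∑ i, (x i k - x i l) ^ 2 := by positivity
  rw [sum_sq_sub_eq_of_standardized hx] at hsq
  linarith

theorem abs_le_maxEntry (x : Fin n → Fin p → ℝ) (i : Fin n) (j : Fin p) :
    |x i j| ≤ maxEntry x :=
  (le_ciSup (f := fun j => |x i j|) (Set.finite_range _).bddAbove j).trans
    (le_ciSup (f := fun i => ⨆ j, |x i j|) (Set.finite_range _).bddAbove i)

theorem one_le_maxEntry_of_standardized (hn : 0 < n) (hx : Standardized x) (j : Fin p) :
    1 ≤ maxEntry x := by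
  have : (0 : ℝ) < n := by exact_mod_cast hn
  have hsq : 1 ≤ maxEntry x ^ 2 := by
    calc 1 = (1 / (n : ℝ)) * ∑ i, x i j ^ 2 := (hx j).1.symm
      _ ≤ (1 / (n : ℝ)) * ∑ _i : Fin n, maxEntry x ^ 2 := by
        gcongr _ * ∑ i, ?_ with i
        exact sq_le_sq.mpr ((abs_le_maxEntry x i j).trans (le_abs_self _))
      _ = maxEntry x ^ 2 := by
        rw [Finset.sum_const, Finset.card_univ, Fintype.card_fin, nsmul_eq_mul]
        field_simp
  exact (one_le_sq_iff₀ ((abs_nonneg _).trans (abs_le_maxEntry x ⟨0, hn⟩ j))).mp hsq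

theorem abs_dotProduct_le {v : Fin p → ℝ} {L : ℝ} (hv : ∀ j, |v j| ≤ L) (b : Fin p → ℝ) :
    |v ⬝ᵥ b| ≤ L * ∑ j, |b j| := by
  rw [dotProduct, Finset.mul_sum]
  refine (Finset.abs_sum_le_sum_abs _ _).trans (Finset.sum_le_sum fun j _ => ?_)
  rw [abs_mul]
  exact mul_le_mul_of_nonneg_right (hv j) (abs_nonneg _)

theorem sum_abs_le_of_card_coefSupport_le {D : ℕ} {B : ℝ} (hB : 0 ≤ B)
    (hD : (coefSupport b).card ≤ D) (hb : ∀ j, |b j| ≤ B) : ∑ j, |b j| ≤ D * B := by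
  calc ∑ j, |b j| = ∑ j ∈ coefSupport b, |b j| :=
        (Finset.sum_subset (Finset.subset_univ _) fun j _ hj => by
          simpa [coefSupport] using hj).symm
    _ ≤ ∑ _j ∈ coefSupport b, B := Finset.sum_le_sum fun j _ => hb j
    _ = (coefSupport b).card * B := by rw [Finset.sum_const, nsmul_eq_mul]
    _ ≤ D * B := by gcongr

theorem sum_abs_add_smul_sub_le (h : ∑ j, |b' j| ≤ ∑ j, |b j|) {t : ℝ}
    (ht : t ∈ Set.Icc (0 : ℝ) 1) : ∑ j, |(b + t • (b' - b)) j| ≤ ∑ j, |b j| := by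
  have ht' : 0 ≤ 1 - t := sub_nonneg.mpr ht.2
  have hj : ∀ j, |(b + t • (b' - b)) j| ≤ (1 - t) * |b j| + t * |b' j| := fun j => by
    calc |(b + t • (b' - b)) j| = |(1 - t) * b j + t * b' j| := by
          simp only [Pi.add_apply, Pi.smul_apply, Pi.sub_apply, smul_eq_mul]
          ring_nf
      _ ≤ |(1 - t) * b j| + |t * b' j| := abs_add_le _ _
      _ = (1 - t) * |b j| + t * |b' j| := by
          rw [abs_mul, abs_mul, abs_of_nonneg ht', abs_of_nonneg ht.1]
  calc ∑ j, |(b + t • (b' - b)) j| ≤ ∑ j, ((1 - t) * |b j| + t * |b' j|) :=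
        Finset.sum_le_sum fun j _ => hj j
    _ = (1 - t) * ∑ j, |b j| + t * ∑ j, |b' j| := by
        rw [Finset.sum_add_distrib, Finset.mul_sum, Finset.mul_sum]
    _ ≤ (1 - t) * ∑ j, |b j| + t * ∑ j, |b j| := by
        have := ht.1
        gcongr
    _ = ∑ j, |b j| := by ring

theorem deriv_nonneg_of_isMinOn_Icc {f : ℝ → ℝ} {f' : ℝ} (hf : HasDerivAt f f' 0)
    (hmin : IsMinOn f (Set.Icc 0 1) 0) : 0 ≤ f' := by
  have hcone : (1 : ℝ) ∈ posTangentConeAt (Set.Icc 0 1) 0 :=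
    mem_posTangentConeAt_of_segment_subset (by rw [zero_add, segment_eq_Icc zero_le_one])
  simpa using hmin.localize.hasFDerivWithinAt_nonneg
    hf.hasDerivWithinAt.hasFDerivWithinAt hcone

theorem hasDerivAt_nbLoss_line {θ : ℝ} (hθ : 0 < θ) (b v : Fin p → ℝ) :
    HasDerivAt (fun t : ℝ => nbLoss θ x y (b + t • v))
      (-((1 / (n : ℝ)) * ∑ i, nbScore θ (y i) (x i ⬝ᵥ b) * (x i ⬝ᵥ v))) 0 := by
  simp only [nbLoss_eq_sum, dotProduct_add, dotProduct_smul, smul_eq_mul]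
  rw [← mul_neg, ← Finset.sum_neg_distrib]
  simp only [← neg_mul]
  refine HasDerivAt.const_mul _ (HasDerivAt.fun_sum fun i _ => ?_)
  have hline : HasDerivAt (fun t : ℝ => x i ⬝ᵥ b + t * (x i ⬝ᵥ v)) (x i ⬝ᵥ v) 0 := by
    simpa using ((hasDerivAt_id (0 : ℝ)).mul_const (x i ⬝ᵥ v)).const_add (x i ⬝ᵥ b)
  exact HasDerivAt.comp_of_eq (h₂ := nbNegLog θ (y i)) 0 (hasDerivAt_nbNegLog hθ _ _) hline
    (by ring)

theorem hasDerivAt_sum_sq_line (b v : Fin p → ℝ) :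
    HasDerivAt (fun t : ℝ => ∑ j, (b + t • v) j ^ 2) (2 * (b ⬝ᵥ v)) 0 := by
  rw [dotProduct, Finset.mul_sum]
  refine HasDerivAt.fun_sum fun j _ => ?_
  have hline : HasDerivAt (fun t : ℝ => b j + t * v j) (v j) 0 := by
    simpa using ((hasDerivAt_id (0 : ℝ)).mul_const (v j)).const_add (b j)
  exact (hline.pow 2).congr_deriv (by simp [mul_assoc])

theorem dotProduct_sub_comp_swap (v b : Fin p → ℝ) (k l : Fin p) :
    v ⬝ᵥ (b - b ∘ Equiv.swap k l) = (b k - b l) * (v k - v l) := by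
  have hdir : b - b ∘ Equiv.swap k l
      = (b k - b l) • (Pi.single k 1 - Pi.single l 1 : Fin p → ℝ) := by
    ext j
    rcases eq_or_ne j k with rfl | hk
    · rcases eq_or_ne j l with rfl | hl
      · simp
      · simp [hl]
    · rcases eq_or_ne j l with rfl | hl
      · simp [hk]
      · simp [Equiv.swap_apply_of_ne_of_ne hk hl, hk, hl]
  rw [hdir, dotProduct_smul, dotProduct_sub, dotProduct_single_one, dotProduct_single_one,
    smul_eq_mul]

namespace IsElasticNet

variable {θ lam1 lam2 : ℝ}

theorem enObjective_le (hb : IsElasticNet θ lam1 lam2 x y b) (b' : Fin p → ℝ) :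
    enObjective θ lam1 lam2 x y b ≤ enObjective θ lam1 lam2 x y b' :=
  hb (Set.mem_univ b')

/-- Along the segment towards `b'` the `ℓ¹` penalty does not grow, so the smooth part of the
objective cannot have a negative derivative at `b`. -/
theorem variational (hb : IsElasticNet θ lam1 lam2 x y b) (hθ : 0 < θ) (hlam1 : 0 ≤ lam1)
    (hb' : ∑ j, |b' j| ≤ ∑ j, |b j|) :
    2 * lam2 * (b ⬝ᵥ (b - b')) ≤
      (1 / (n : ℝ)) * ∑ i, nbScore θ (y i) (x i ⬝ᵥ b) * (x i ⬝ᵥ (b - b')) := by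
  have hderiv := (hasDerivAt_nbLoss_line (x := x) (y := y) hθ b (b' - b)).fun_add
    ((hasDerivAt_sum_sq_line b (b' - b)).const_mul lam2)
  have hmin : IsMinOn (fun t : ℝ => nbLoss θ x y (b + t • (b' - b))
      + lam2 * ∑ j, (b + t • (b' - b)) j ^ 2) (Set.Icc 0 1) 0 := by
    intro t ht
    have hobj := hb.enObjective_le (b + t • (b' - b))
    have hl1 := mul_le_mul_of_nonneg_left (sum_abs_add_smul_sub_le hb' ht) hlam1
    simp only [enObjective] at hobj
    simp only [Set.mem_ofPred_eq, zero_smul, add_zero]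
    linarith
  have hnonneg := deriv_nonneg_of_isMinOn_Icc hderiv hmin
  rw [← neg_sub b b'] at hnonneg
  simp only [dotProduct_neg, mul_neg, Finset.sum_neg_distrib] at hnonneg
  linarith

/-- Exchanging the coefficients `k` and `l` preserves the `ℓ¹` norm. -/
theorem first_order_swap (hb : IsElasticNet θ lam1 lam2 x y b) (hθ : 0 < θ)
    (hlam1 : 0 ≤ lam1) (k l : Fin p) :
    2 * lam2 * (b k - b l) ^ 2 ≤ (b k - b l) *
      ((1 / (n : ℝ)) * ∑ i, nbScore θ (y i) (x i ⬝ᵥ b) * (x i k - x i l)) := by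
  have hvar := hb.variational (b' := b ∘ Equiv.swap k l) hθ hlam1
    (Equiv.sum_comp (Equiv.swap k l) fun j => |b j|).le
  simp only [dotProduct_sub_comp_swap, mul_left_comm _ (b k - b l), ← Finset.mul_sum] at hvar
  linarith

theorem sq_sub_le (hb : IsElasticNet θ lam1 lam2 x y b) (hθ : 0 < θ) (hlam1 : 0 ≤ lam1)
    (hlam2 : 0 < lam2) (hx : Standardized x) (k l : Fin p) :
    (b k - b l) ^ 2 ≤ 1 / 2 * (1 - empCorr x k l) *
      (1 / lam2 ^ 2 * ((1 / (n : ℝ)) * ∑ i, nbScore θ (y i) (x i ⬝ᵥ b) ^ 2)) := by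
  have hfirst := hb.first_order_swap hθ hlam1 k l
  set s := (1 / (n : ℝ)) * ∑ i, nbScore θ (y i) (x i ⬝ᵥ b) * (x i k - x i l)
  set W := (1 / (n : ℝ)) * ∑ i, nbScore θ (y i) (x i ⬝ᵥ b) ^ 2
  have hcauchy : s ^ 2 ≤ W * (2 * (1 - empCorr x k l)) := by
    rw [← sum_sq_sub_eq_of_standardized hx k l, mul_mul_mul_comm, mul_pow, ← sq]
    gcongr
    exact Finset.sum_mul_sq_le_sq_mul_sq _ _ _
  have habs : |2 * lam2 * (b k - b l)| ≤ |s| := by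
    rw [abs_mul, abs_of_pos (by positivity : 0 < 2 * lam2)]
    rcases eq_or_ne (b k - b l) 0 with h0 | h0
    · rw [h0, abs_zero, mul_zero]
      exact abs_nonneg s
    · refine le_of_mul_le_mul_left ?_ (abs_pos.mpr h0)
      calc |b k - b l| * (2 * lam2 * |b k - b l|) = 2 * lam2 * (b k - b l) ^ 2 := by
            rw [← sq_abs (b k - b l)]
            ring
        _ ≤ |b k - b l| * |s| := (hfirst.trans (le_abs_self _)).trans_eq (abs_mul _ _)
  have hsq : 4 * lam2 ^ 2 * (b k - b l) ^ 2 ≤ W * (2 * (1 - empCorr x k l)) :=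
    (by linarith [sq_le_sq.mpr habs] : 4 * lam2 ^ 2 * (b k - b l) ^ 2 ≤ s ^ 2).trans hcauchy
  calc (b k - b l) ^ 2 ≤ W * (2 * (1 - empCorr x k l)) / (4 * lam2 ^ 2) := by
        rwa [le_div_iff₀' (by positivity)]
    _ = _ := by
        field_simp
        ring

end IsElasticNet

end Design

/-- A bound for the linear predictors of the elastic net and of the true coefficient vector when
the latter has at most `D` nonzero entries, all bounded by `B`, and the design is bounded by
`L`. -/
noncomputable def predRadius (L B : ℝ) (D : ℕ) : ℝ :=
  4 * (L * (D * B))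

/-- The constant for which the excess of the mean squared score over the shrunk mean squared
residual is at most `slowConst * λ₂`. -/
noncomputable def slowConst (θ L B : ℝ) (D : ℕ) : ℝ :=
  Real.exp (predRadius L B D) ^ 2 / (1 - nbShrink θ (predRadius L B D))
    * (13 / 4 * (D * B) / nbCurv θ (predRadius L B D)) * (8 * B)

/-- The part of the variance bound that is left over after the residuals have been shrunk; it
absorbs the error term of order `λ₂`. -/
noncomputable def shrinkGap (θ L B : ℝ) (D : ℕ) : ℝ :=
  (1 - nbShrink θ (predRadius L B D)) * varBound θ L B

/-- The constant `O(1)` of the grouping inequality. -/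
noncomputable def groupConst (θ L B : ℝ) (D : ℕ) : ℝ :=
  slowConst θ L B D ^ 2 / (4 * shrinkGap θ L B D)

/-- The sample `(x, y)` is such that the oracle inequality holds deterministically: the design is
bounded by `L`, the gradient of the loss at the coefficient vector `b'` is dominated by half the
penalty level, and the mean squared residual at `b'` exceeds its expectation by at most `E`. -/
structure IsGoodSample {n p : ℕ} (θ L B E lam1 : ℝ) (x : Fin n → Fin p → ℝ) (y : Fin n → ℕ)
    (b' : Fin p → ℝ) : Prop where
  bounded : ∀ i j, |x i j| ≤ L
  gradient : ∀ j, |(1 / (n : ℝ)) * ∑ i, nbScore θ (y i) (x i ⬝ᵥ b') * x i j| ≤ lam1 / 2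
  residual : (1 / (n : ℝ)) * ∑ i, ((y i : ℝ) - Real.exp (x i ⬝ᵥ b')) ^ 2 ≤ E + varBound θ L B

section Oracle

variable {n p D : ℕ} {θ L B E R lam1 lam2 : ℝ} {x : Fin n → Fin p → ℝ} {y : Fin n → ℕ}
  {b b' : Fin p → ℝ}

theorem varBound_pos (hθ : 0 < θ) (L B : ℝ) : 0 < varBound θ L B := by
  unfold varBound
  positivity

theorem shrinkGap_pos (hθ : 0 < θ) (L B : ℝ) (D : ℕ) : 0 < shrinkGap θ L B D :=
  mul_pos (sub_pos.mpr (nbShrink_lt_one hθ _)) (varBound_pos hθ L B)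

theorem groupConst_nonneg (hθ : 0 < θ) (L B : ℝ) (D : ℕ) : 0 ≤ groupConst θ L B D := by
  have := shrinkGap_pos hθ L B D
  unfold groupConst
  positivity

theorem nbLoss_quadratic_lower (hθ : 0 < θ) (hR' : ∀ i, |x i ⬝ᵥ b'| ≤ R)
    (hR : ∀ i, |x i ⬝ᵥ b| ≤ R) :
    nbLoss θ x y b' - ∑ j, ((1 / (n : ℝ)) * ∑ i, nbScore θ (y i) (x i ⬝ᵥ b') * x i j)
        * (b j - b' j)
      + nbCurv θ R / 2 * ((1 / (n : ℝ)) * ∑ i, (x i ⬝ᵥ b - x i ⬝ᵥ b') ^ 2)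
      ≤ nbLoss θ x y b := by
  have hgrad : ∑ j, ((1 / (n : ℝ)) * ∑ i, nbScore θ (y i) (x i ⬝ᵥ b') * x i j) * (b j - b' j)
      = (1 / (n : ℝ)) * ∑ i, nbScore θ (y i) (x i ⬝ᵥ b') * (x i ⬝ᵥ b - x i ⬝ᵥ b') := by
    simp only [← dotProduct_sub, mul_assoc, Finset.sum_mul, ← Finset.mul_sum]
    rw [Finset.sum_comm]
    simp only [dotProduct, Finset.mul_sum, Pi.sub_apply]
  have hsum : ∑ i, (nbNegLog θ (y i) (x i ⬝ᵥ b')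
      - nbScore θ (y i) (x i ⬝ᵥ b') * (x i ⬝ᵥ b - x i ⬝ᵥ b')
      + nbCurv θ R / 2 * (x i ⬝ᵥ b - x i ⬝ᵥ b') ^ 2) ≤ ∑ i, nbNegLog θ (y i) (x i ⬝ᵥ b) :=
    Finset.sum_le_sum fun i _ => nbNegLog_quadratic_lower hθ (Nat.cast_nonneg _) (hR' i) (hR i)
  rw [Finset.sum_add_distrib, Finset.sum_sub_distrib, ← Finset.mul_sum] at hsum
  have hmean := mul_le_mul_of_nonneg_left hsum (by positivity : (0 : ℝ) ≤ 1 / (n : ℝ))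
  rw [hgrad, nbLoss_eq_sum, nbLoss_eq_sum]
  linarith

theorem mean_nbScore_sq_le (hθ : 0 < θ) (hR' : ∀ i, |x i ⬝ᵥ b'| ≤ R)
    (hR : ∀ i, |x i ⬝ᵥ b| ≤ R) :
    (1 / (n : ℝ)) * ∑ i, nbScore θ (y i) (x i ⬝ᵥ b) ^ 2
      ≤ nbShrink θ R * ((1 / (n : ℝ)) * ∑ i, ((y i : ℝ) - Real.exp (x i ⬝ᵥ b')) ^ 2)
        + Real.exp R ^ 2 / (1 - nbShrink θ R)
          * ((1 / (n : ℝ)) * ∑ i, (x i ⬝ᵥ b - x i ⬝ᵥ b') ^ 2) := by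
  have hsum := Finset.sum_le_sum fun i (_ : i ∈ Finset.univ) =>
    nbScore_sq_le (y := y i) hθ (hR' i) (hR i)
  rw [Finset.sum_add_distrib, ← Finset.mul_sum, ← Finset.mul_sum] at hsum
  have hmean := mul_le_mul_of_nonneg_left hsum (by positivity : (0 : ℝ) ≤ 1 / (n : ℝ))
  linarith

theorem sum_mul_sub_le {g : Fin p → ℝ} {c : ℝ} (hc : 0 ≤ c) (hg : ∀ j, |g j| ≤ c) :
    ∑ j, g j * (b j - b' j) ≤ c * (∑ j, |b j| + ∑ j, |b' j|) := by
  rw [← Finset.sum_add_distrib, Finset.mul_sum]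
  refine Finset.sum_le_sum fun j _ => (le_abs_self _).trans ?_
  rw [abs_mul]
  exact mul_le_mul (hg j) (abs_sub _ _) (abs_nonneg _) hc

theorem sum_sq_le_mul_sum_abs (hb : ∀ j, |b j| ≤ B) : ∑ j, b j ^ 2 ≤ B * ∑ j, |b j| := by
  rw [Finset.mul_sum]
  refine Finset.sum_le_sum fun j _ => ?_
  rw [← sq_abs, sq]
  exact mul_le_mul_of_nonneg_right (hb j) (abs_nonneg _)

theorem IsGoodSample.abs_predictor_le (G : IsGoodSample θ L B E lam1 x y b') (hL : 0 ≤ L)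
    (hB : 0 ≤ B) (hb'B : ∀ j, |b' j| ≤ B) (hD : (coefSupport b').card ≤ D) (i : Fin n) :
    |x i ⬝ᵥ b'| ≤ predRadius L B D := by
  have hl1 := mul_le_mul_of_nonneg_left (sum_abs_le_of_card_coefSupport_le hB hD hb'B) hL
  have hDB : 0 ≤ L * (D * B) := by positivity
  unfold predRadius
  linarith [abs_dotProduct_le (G.bounded i) b']

namespace IsElasticNet

theorem basic_inequality (hb : IsElasticNet θ lam1 lam2 x y b) (hθ : 0 < θ) (hB : 0 < B)
    (hlam1 : 0 < lam1) (hlam2 : lam2 = lam1 / (8 * B)) (hb'B : ∀ j, |b' j| ≤ B)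
    (G : IsGoodSample θ L B E lam1 x y b') (hR' : ∀ i, |x i ⬝ᵥ b'| ≤ R)
    (hR : ∀ i, |x i ⬝ᵥ b| ≤ R) :
    lam1 / 2 * ∑ j, |b j|
        + nbCurv θ R / 2 * ((1 / (n : ℝ)) * ∑ i, (x i ⬝ᵥ b - x i ⬝ᵥ b') ^ 2)
      ≤ 13 / 8 * lam1 * ∑ j, |b' j| := by
  have hlam2' : 0 < lam2 := by
    rw [hlam2]
    positivity
  have hobj := hb.enObjective_le b'
  simp only [enObjective] at hobj
  have hloss := nbLoss_quadratic_lower (y := y) hθ hR' hR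
  have hgrad := sum_mul_sub_le (b := b) (b' := b') (by positivity) G.gradient
  have hridge : 0 ≤ lam2 * ∑ j, b j ^ 2 := by positivity
  have hridge' : lam2 * ∑ j, b' j ^ 2 ≤ lam1 / 8 * ∑ j, |b' j| := by
    calc lam2 * ∑ j, b' j ^ 2 ≤ lam2 * (B * ∑ j, |b' j|) := by
          gcongr
          exact sum_sq_le_mul_sum_abs hb'B
      _ = lam1 / 8 * ∑ j, |b' j| := by
          rw [hlam2]
          field_simp
  linarith

theorem sum_abs_le (hb : IsElasticNet θ lam1 lam2 x y b) (hθ : 0 < θ) (hL : 0 ≤ L)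
    (hB : 0 < B) (hlam1 : 0 < lam1) (hlam2 : lam2 = lam1 / (8 * B)) (hb'B : ∀ j, |b' j| ≤ B)
    (G : IsGoodSample θ L B E lam1 x y b') :
    ∑ j, |b j| ≤ 13 / 4 * ∑ j, |b' j| := by
  have hl1 : 0 ≤ ∑ j, |b j| := by positivity
  have hl1' : 0 ≤ ∑ j, |b' j| := by positivity
  have hbasic := hb.basic_inequality (R := L * (∑ j, |b j| + ∑ j, |b' j|)) hθ hB hlam1 hlam2
    hb'B G (fun i => (abs_dotProduct_le (G.bounded i) b').trans (by gcongr; linarith))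
    (fun i => (abs_dotProduct_le (G.bounded i) b).trans (by gcongr; linarith))
  have hcurv := nbCurv_pos hθ (L * (∑ j, |b j| + ∑ j, |b' j|))
  have hV : 0 ≤ nbCurv θ (L * (∑ j, |b j| + ∑ j, |b' j|)) / 2
      * ((1 / (n : ℝ)) * ∑ i, (x i ⬝ᵥ b - x i ⬝ᵥ b') ^ 2) := by positivity
  refine le_of_mul_le_mul_left ?_ (half_pos hlam1)
  linarith

theorem abs_predictor_le (hb : IsElasticNet θ lam1 lam2 x y b) (hθ : 0 < θ) (hL : 0 ≤ L)
    (hB : 0 < B) (hlam1 : 0 < lam1) (hlam2 : lam2 = lam1 / (8 * B)) (hb'B : ∀ j, |b' j| ≤ B)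
    (hD : (coefSupport b').card ≤ D) (G : IsGoodSample θ L B E lam1 x y b') (i : Fin n) :
    |x i ⬝ᵥ b| ≤ predRadius L B D := by
  have hl1 : ∑ j, |b j| ≤ 4 * (D * B) := by
    have hl1' := sum_abs_le_of_card_coefSupport_le hB.le hD hb'B
    have hDB : 0 ≤ D * B := by positivity
    linarith [hb.sum_abs_le hθ hL hB hlam1 hlam2 hb'B G]
  calc |x i ⬝ᵥ b| ≤ L * ∑ j, |b j| := abs_dotProduct_le (G.bounded i) b
    _ ≤ L * (4 * (D * B)) := by gcongr
    _ = predRadius L B D := mul_left_comm _ _ _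

theorem mean_sq_prediction_error_le (hb : IsElasticNet θ lam1 lam2 x y b) (hθ : 0 < θ)
    (hL : 0 ≤ L) (hB : 0 < B) (hlam1 : 0 < lam1) (hlam2 : lam2 = lam1 / (8 * B))
    (hb'B : ∀ j, |b' j| ≤ B) (hD : (coefSupport b').card ≤ D)
    (G : IsGoodSample θ L B E lam1 x y b') :
    (1 / (n : ℝ)) * ∑ i, (x i ⬝ᵥ b - x i ⬝ᵥ b') ^ 2
      ≤ 13 / 4 * (D * B) / nbCurv θ (predRadius L B D) * lam1 := by
  have hbasic := hb.basic_inequality hθ hB hlam1 hlam2 hb'B G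
    (G.abs_predictor_le hL hB.le hb'B hD) (hb.abs_predictor_le hθ hL hB hlam1 hlam2 hb'B hD G)
  have hl1 : 0 ≤ lam1 * ∑ j, |b j| := by positivity
  have hl1' := mul_le_mul_of_nonneg_left (sum_abs_le_of_card_coefSupport_le hB.le hD hb'B)
    hlam1.le
  rw [div_mul_eq_mul_div _ (nbCurv θ _), le_div_iff₀ (nbCurv_pos hθ _)]
  linarith

theorem mean_nbScore_sq_le_groupConst (hb : IsElasticNet θ lam1 lam2 x y b) (hθ : 0 < θ)
    (hL : 0 ≤ L) (hB : 0 < B) (hE : 0 ≤ E) (hlam1 : 0 < lam1)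
    (hlam2 : lam2 = lam1 / (8 * B)) (hb'B : ∀ j, |b' j| ≤ B)
    (hD : (coefSupport b').card ≤ D) (G : IsGoodSample θ L B E lam1 x y b') :
    (1 / (n : ℝ)) * ∑ i, nbScore θ (y i) (x i ⬝ᵥ b) ^ 2
      ≤ lam2 ^ 2 * groupConst θ L B D + (E + varBound θ L B) := by
  have hlam1' : lam1 = 8 * B * lam2 := by
    rw [hlam2]
    field_simp
  have hs := nbShrink_pos hθ (predRadius L B D)
  have hs1 := sub_pos.mpr (nbShrink_lt_one hθ (predRadius L B D))
  have hgap := shrinkGap_pos hθ L B D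
  -- the square `(λ₂ slowConst - 2 gap)² ≥ 0`
  have habsorb : slowConst θ L B D * lam2
      ≤ lam2 ^ 2 * groupConst θ L B D + shrinkGap θ L B D := by
    have hsq : lam2 ^ 2 * groupConst θ L B D + shrinkGap θ L B D - slowConst θ L B D * lam2
        = (lam2 * slowConst θ L B D - 2 * shrinkGap θ L B D) ^ 2 / (4 * shrinkGap θ L B D) := by
      unfold groupConst
      field_simp
      ring
    have : 0 ≤ (lam2 * slowConst θ L B D - 2 * shrinkGap θ L B D) ^ 2
      / (4 * shrinkGap θ L B D) := by positivity
    linarith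
  calc (1 / (n : ℝ)) * ∑ i, nbScore θ (y i) (x i ⬝ᵥ b) ^ 2
    _ ≤ _ := mean_nbScore_sq_le hθ (G.abs_predictor_le hL hB.le hb'B hD)
        (hb.abs_predictor_le hθ hL hB hlam1 hlam2 hb'B hD G)
    _ ≤ nbShrink θ (predRadius L B D) * (E + varBound θ L B)
        + Real.exp (predRadius L B D) ^ 2 / (1 - nbShrink θ (predRadius L B D))
          * (13 / 4 * (D * B) / nbCurv θ (predRadius L B D) * lam1) := by
        gcongr _ * ?_ + _ * ?_
        · exact G.residual
        · exact hb.mean_sq_prediction_error_le hθ hL hB hlam1 hlam2 hb'B hD G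
    _ = nbShrink θ (predRadius L B D) * (E + varBound θ L B) + slowConst θ L B D * lam2 := by
        rw [hlam1', slowConst]
        ring
    _ ≤ nbShrink θ (predRadius L B D) * (E + varBound θ L B)
        + (lam2 ^ 2 * groupConst θ L B D + shrinkGap θ L B D) := by gcongr
    _ ≤ lam2 ^ 2 * groupConst θ L B D + (E + varBound θ L B) := by
        unfold shrinkGap
        linarith [mul_nonneg hs1.le hE]

theorem grouping_oracle (hb : IsElasticNet θ lam1 lam2 x y b) (hθ : 0 < θ) (hL : 0 ≤ L)
    (hB : 0 < B) (hE : 0 ≤ E) (hlam1 : 0 < lam1) (hlam2 : lam2 = lam1 / (8 * B))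
    (hb'B : ∀ j, |b' j| ≤ B) (hD : (coefSupport b').card ≤ D)
    (G : IsGoodSample θ L B E lam1 x y b') (hx : Standardized x) (k l : Fin p) :
    |b k - b l| ^ 2 ≤ 1 / 2 * (1 - empCorr x k l)
      * (groupConst θ L B D + 1 / lam2 ^ 2 * (E + varBound θ L B)) := by
  have hlam2' : 0 < lam2 := by
    rw [hlam2]
    positivity
  have hρ := one_sub_empCorr_nonneg hx k l
  calc |b k - b l| ^ 2 = (b k - b l) ^ 2 := sq_abs _
    _ ≤ _ := hb.sq_sub_le hθ hlam1.le hlam2' hx k l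
    _ ≤ 1 / 2 * (1 - empCorr x k l)
        * (1 / lam2 ^ 2 * (lam2 ^ 2 * groupConst θ L B D + (E + varBound θ L B))) := by
        gcongr
        exact hb.mean_nbScore_sq_le_groupConst hθ hL hB hE hlam1 hlam2 hb'B hD G
    _ = _ := by field_simp

end IsElasticNet

end Oracle

/-- The variance of the negative binomial law with dispersion `θ` and mean `m`. -/
noncomputable def nbVariance (θ m : ℝ) : ℝ :=
  m * (θ + m) / θ

section NegativeBinomial

variable {θ m : ℝ}

theorem nbPMF_nonneg (hθ : 0 < θ) (hm : 0 < m) (y : ℕ) : 0 ≤ nbPMF θ m y := by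
  have := Real.Gamma_pos_of_pos (show 0 < θ + y by positivity)
  have := Real.Gamma_pos_of_pos hθ
  unfold nbPMF
  positivity

theorem ascPochhammer_eval_mul_gamma (hθ : 0 < θ) (y : ℕ) :
    (ascPochhammer ℝ y).eval θ * Real.Gamma θ = Real.Gamma (θ + y) := by
  induction y with
  | zero => simp
  | succ y ih =>
    rw [ascPochhammer_succ_eval, Nat.cast_add_one, ← add_assoc,
      Real.Gamma_add_one (by positivity), ← ih]
    ring

theorem ringChoose_eq_gamma (hθ : 0 < θ) (y : ℕ) :
    Ring.choose (θ + y - 1) y = Real.Gamma (θ + y) / (Real.Gamma θ * (y.factorial : ℝ)) := by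
  have := Real.Gamma_pos_of_pos hθ
  have hchoose := Ring.factorial_nsmul_multichoose_eq_ascPochhammer θ y
  rw [Polynomial.ascPochhammer_smeval_eq_eval, nsmul_eq_mul] at hchoose
  rw [← Ring.multichoose_eq, ← ascPochhammer_eval_mul_gamma hθ, ← hchoose]
  field_simp

/-- The binomial series of `(1 - m / (θ + m)) ^ (-θ)`. -/
theorem hasSum_nbPMF (hθ : 0 < θ) (hm : 0 < m) : HasSum (nbPMF θ m) 1 := by
  have hq : m / (θ + m) < 1 := by
    rw [div_lt_one (by positivity)]
    linarith
  have hseries := (Real.one_div_one_sub_rpow_hasFPowerSeriesOnBall_zero θ).hasSum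
    (y := m / (θ + m)) (by
      rw [Metric.mem_eball, edist_zero_right, Real.enorm_of_nonneg (by positivity),
        ENNReal.ofReal_lt_one]
      exact hq)
  have hone : 1 - m / (θ + m) = θ / (θ + m) := by
    field_simp
    ring
  have hpos : (0 : ℝ) < (θ / (θ + m)) ^ θ := by positivity
  have hsum := hseries.mul_right ((θ / (θ + m)) ^ θ)
  rw [zero_add, hone, one_div, inv_mul_cancel₀ hpos.ne'] at hsum
  refine hsum.congr_fun fun y => ?_
  simp [FormalMultilinearSeries.ofScalars, ringChoose_eq_gamma hθ, nbPMF]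

/-- Size-biasing a negative binomial law raises the dispersion by one. -/
theorem succ_mul_nbPMF_succ (hθ : 0 < θ) (hm : 0 < m) (y : ℕ) :
    ((y : ℝ) + 1) * nbPMF θ m (y + 1) = m * nbPMF (θ + 1) (m * (θ + 1) / θ) y := by
  have := Real.Gamma_pos_of_pos hθ
  have hq : m * (θ + 1) / θ / (θ + 1 + m * (θ + 1) / θ) = m / (θ + m) := by field_simp
  have hr : (θ + 1) / (θ + 1 + m * (θ + 1) / θ) = θ / (θ + m) := by field_simp
  have hsucc : θ + ((y + 1 : ℕ) : ℝ) = θ + 1 + y := by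
    push_cast
    ring
  have hratio : m / (θ + m) = m / θ * (θ / (θ + m)) := by field_simp
  rw [nbPMF, nbPMF, hq, hr, hsucc, Nat.factorial_succ, pow_succ, Real.Gamma_add_one hθ.ne',
    Real.rpow_add_one (by positivity)]
  generalize θ / (θ + m) = r at hratio ⊢
  generalize m / (θ + m) = q at hratio ⊢
  rw [mul_assoc (_ / _) (q ^ y * q), mul_assoc (q ^ y), hratio]
  push_cast
  field_simp

theorem hasSum_descPochhammer_mul_nbPMF (k : ℕ) (hθ : 0 < θ) (hm : 0 < m) :
    HasSum (fun y : ℕ => (descPochhammer ℝ k).eval (y : ℝ) * nbPMF θ m y)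
      ((ascPochhammer ℝ k).eval θ * (m / θ) ^ k) := by
  induction k generalizing θ m with
  | zero => simpa using hasSum_nbPMF hθ hm
  | succ k ih =>
    have hsum := (ih (θ := θ + 1) (m := m * (θ + 1) / θ) (by positivity)
      (by positivity)).mul_left m
    have hshift : HasSum (fun y : ℕ =>
        (descPochhammer ℝ (k + 1)).eval ((y + 1 : ℕ) : ℝ) * nbPMF θ m (y + 1))
        ((ascPochhammer ℝ (k + 1)).eval θ * (m / θ) ^ (k + 1)) := by
      have hvalue : (ascPochhammer ℝ (k + 1)).eval θ * (m / θ) ^ (k + 1) =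
          m * ((ascPochhammer ℝ k).eval (θ + 1) * (m * (θ + 1) / θ / (θ + 1)) ^ k) := by
        have hmean : m * (θ + 1) / θ / (θ + 1) = m / θ := by field_simp
        simp only [ascPochhammer_succ_left, Polynomial.eval_mul, Polynomial.eval_X,
          Polynomial.eval_comp, Polynomial.eval_add, Polynomial.eval_one, hmean, pow_succ]
        field_simp
      rw [hvalue]
      refine hsum.congr_fun fun y => ?_
      have hsize := succ_mul_nbPMF_succ hθ hm y
      simp only [descPochhammer_succ_left, Polynomial.eval_mul, Polynomial.eval_X,
        Polynomial.eval_comp, Polynomial.eval_sub, Polynomial.eval_one, Nat.cast_add_one,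
        add_sub_cancel_right]
      linear_combination (descPochhammer ℝ k).eval (y : ℝ) * hsize
    rw [← hasSum_nat_add_iff' 1]
    simpa using hshift

theorem hasSum_id_mul_nbPMF (hθ : 0 < θ) (hm : 0 < m) :
    HasSum (fun y : ℕ => (y : ℝ) * nbPMF θ m y) m := by
  simpa [hθ.ne', mul_div_cancel₀] using hasSum_descPochhammer_mul_nbPMF 1 hθ hm

theorem hasSum_sub_sq_mul_nbPMF (hθ : 0 < θ) (hm : 0 < m) :
    HasSum (fun y : ℕ => ((y : ℝ) - m) ^ 2 * nbPMF θ m y) (nbVariance θ m) := by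
  have h0 := hasSum_nbPMF hθ hm
  have h1 := hasSum_id_mul_nbPMF hθ hm
  have h2 := hasSum_descPochhammer_mul_nbPMF 2 hθ hm
  simp only [descPochhammer_succ_eval, ascPochhammer_succ_eval, descPochhammer_zero,
    ascPochhammer_zero, Polynomial.eval_one] at h2
  convert (h2.add (h1.mul_left (1 - 2 * m))).add (h0.mul_left (m ^ 2)) using 1
  · ext y
    push_cast
    ring
  · unfold nbVariance
    push_cast
    field_simp
    ring

theorem hasSum_sq_sub_variance_sq_mul_nbPMF (hθ : 0 < θ) (hm : 0 < m) :
    HasSum (fun y : ℕ => (((y : ℝ) - m) ^ 2 - nbVariance θ m) ^ 2 * nbPMF θ m y)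
      ((2 + 6 / θ) * nbVariance θ m ^ 2 + nbVariance θ m) := by
  have h0 := hasSum_nbPMF hθ hm
  have h1 := hasSum_id_mul_nbPMF hθ hm
  have h2 := hasSum_descPochhammer_mul_nbPMF 2 hθ hm
  have h3 := hasSum_descPochhammer_mul_nbPMF 3 hθ hm
  have h4 := hasSum_descPochhammer_mul_nbPMF 4 hθ hm
  simp only [descPochhammer_succ_eval, ascPochhammer_succ_eval, descPochhammer_zero,
    ascPochhammer_zero, Polynomial.eval_one] at h2 h3 h4
  set a := m ^ 2 - nbVariance θ m with ha
  -- the coefficients of `(y² - 2 m y + a)²` in the basis of falling factorials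
  convert (((h4.add (h3.mul_left (6 - 4 * m))).add
    (h2.mul_left (7 - 12 * m + 4 * m ^ 2 + 2 * a))).add
    (h1.mul_left (1 - 4 * m + 4 * m ^ 2 + 2 * a - 4 * m * a))).add (h0.mul_left (a ^ 2)) using 1
  · ext y
    push_cast
    rw [ha]
    ring
  · rw [ha]
    unfold nbVariance
    push_cast
    field_simp
    ring

end NegativeBinomial

section MomentGeneratingFunction

variable {ι : Type*} {w z : ι → ℝ} {M : ℕ → ℝ} {a C : ℝ}

theorem summable_exp_term_of_moments (hw : ∀ i, 0 ≤ w i) (hz : ∀ i, 0 ≤ z i)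
    (hM : ∀ q, HasSum (fun i => z i ^ q * w i) (M q))
    (hC : ∀ q, 1 ≤ q → M q ≤ q.factorial * C ^ q) (haC : |a| * C ≤ 1 / 2) (hC0 : 0 ≤ C) :
    Summable fun r : ℕ × ι => a ^ r.1 / r.1.factorial * (z r.2 ^ r.1 * w r.2) := by
  have habs : ∀ q, HasSum (fun i => |a ^ q / q.factorial * (z i ^ q * w i)|)
      (|a| ^ q / q.factorial * M q) := fun q => by
    refine ((hM q).mul_left _).congr_fun fun i => ?_
    have := hw i
    have := hz i
    rw [abs_mul, abs_div, abs_pow, Nat.abs_cast, abs_of_nonneg (by positivity : 0 ≤ z i ^ q * w i)]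
  refine Summable.of_abs ((summable_prod_of_nonneg fun _ => abs_nonneg _).mpr
    ⟨fun q => (habs q).summable, ?_⟩)
  simp only [fun q => (habs q).tsum_eq]
  rw [← summable_nat_add_iff 1]
  refine Summable.of_nonneg_of_le (fun q => ?_) (fun q => ?_)
    ((summable_nat_add_iff 1).mpr (summable_geometric_of_lt_one (by positivity)
      (haC.trans_lt one_half_lt_one)))
  · have := (hM (q + 1)).nonneg fun i => mul_nonneg (pow_nonneg (hz i) _) (hw i)
    positivity
  · calc |a| ^ (q + 1) / (q + 1).factorial * M (q + 1)
        ≤ |a| ^ (q + 1) / (q + 1).factorial * ((q + 1).factorial * C ^ (q + 1)) := by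
          gcongr
          exact hC _ (by omega)
      _ = (|a| * C) ^ (q + 1) := by
          rw [mul_pow]
          field_simp

theorem exp_series_le_of_moments {S : ℝ} (hM0 : M 0 = 1)
    (hC : ∀ q, 1 ≤ q → M q ≤ q.factorial * C ^ q) (hMnonneg : ∀ q, 0 ≤ M q)
    (haC : |a| * C ≤ 1 / 2) (hC0 : 0 ≤ C)
    (hS : HasSum (fun q : ℕ => a ^ q / q.factorial * M q) S) :
    S ≤ Real.exp (a * M 1 + 2 * (a * C) ^ 2) := by
  have htail := (hasSum_nat_add_iff' 2).mpr hS
  have hgeom := (hasSum_geometric_of_lt_one (by positivity)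
    (haC.trans_lt one_half_lt_one)).mul_left ((|a| * C) ^ 2)
  have hle := hasSum_le (fun q => ?_) htail hgeom
  · have hratio : (1 - |a| * C)⁻¹ ≤ 2 := by
      rw [inv_le_comm₀ (by linarith) two_pos]
      linarith
    have hquad : (|a| * C) ^ 2 * (1 - |a| * C)⁻¹ ≤ (|a| * C) ^ 2 * 2 := by gcongr
    have hsq : (|a| * C) ^ 2 = (a * C) ^ 2 := by rw [mul_pow, mul_pow, sq_abs]
    simp only [Finset.sum_range_succ, Finset.sum_range_zero, pow_zero, pow_one,
      Nat.factorial_zero, Nat.factorial_one, Nat.cast_one, div_one, one_mul, hM0, zero_add]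
      at hle
    linarith [Real.add_one_le_exp (a * M 1 + 2 * (a * C) ^ 2)]
  · calc a ^ (q + 2) / (q + 2).factorial * M (q + 2)
        ≤ |a| ^ (q + 2) / (q + 2).factorial * ((q + 2).factorial * C ^ (q + 2)) := by
          have hpow : a ^ (q + 2) ≤ |a| ^ (q + 2) := (le_abs_self _).trans_eq (abs_pow a _)
          exact mul_le_mul (div_le_div_of_nonneg_right hpow (by positivity)) (hC _ (by omega))
            (hMnonneg _) (by positivity)
      _ = (|a| * C) ^ 2 * (|a| * C) ^ q := by
          rw [← pow_add, add_comm 2 q, mul_pow]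
          field_simp

/-- Expanding the exponential and summing over `ι` first leaves a series in the moments. -/
theorem exists_hasSum_exp_mul_le_of_moments (hw : ∀ i, 0 ≤ w i) (hz : ∀ i, 0 ≤ z i)
    (hM : ∀ q, HasSum (fun i => z i ^ q * w i) (M q)) (hM0 : M 0 = 1)
    (hC : ∀ q, 1 ≤ q → M q ≤ q.factorial * C ^ q) (haC : |a| * C ≤ 1 / 2) :
    ∃ S ≤ Real.exp (a * M 1 + 2 * (a * C) ^ 2), HasSum (fun i => Real.exp (a * z i) * w i) S := by
  have hMnonneg : ∀ q, 0 ≤ M q := fun q =>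
    (hM q).nonneg fun i => mul_nonneg (pow_nonneg (hz i) q) (hw i)
  have hC0 : 0 ≤ C := by simpa using (hMnonneg 1).trans (hC 1 le_rfl)
  obtain ⟨S, hS⟩ := summable_exp_term_of_moments hw hz hM hC haC hC0
  refine ⟨S, exp_series_le_of_moments hM0 hC hMnonneg haC hC0
    (hS.prod_fiberwise fun q => (hM q).mul_left _), ?_⟩
  have hswap := (Equiv.prodComm ι ℕ).hasSum_iff.mpr hS
  refine hswap.prod_fiberwise fun i => ?_
  have hexp := (NormedSpace.expSeries_div_hasSum_exp (a * z i)).mul_right (w i)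
  rw [← Real.exp_eq_exp_ℝ] at hexp
  refine hexp.congr_fun fun q => ?_
  simp only [Function.comp_apply, Equiv.prodComm_apply, Prod.swap_prod_mk, mul_pow]
  ring

end MomentGeneratingFunction

theorem IsMomentConstant.exists_hasSum_exp_mul_sub_le {θ R C t a : ℝ}
    (hC : IsMomentConstant θ R C) (hθ : 0 < θ) (ht : |t| ≤ R) (haC : |a| * C ≤ 1 / 2) :
    ∃ S ≤ Real.exp (2 * (a * C) ^ 2),
      HasSum (fun y : ℕ => Real.exp (a * (y - Real.exp t)) * nbPMF θ (Real.exp t) y) S := by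
  have hpmf := hasSum_nbPMF hθ (Real.exp_pos t)
  have hmean := (hasSum_id_mul_nbPMF hθ (Real.exp_pos t)).tsum_eq
  obtain ⟨S, hS, hsum⟩ := exists_hasSum_exp_mul_le_of_moments (z := fun y : ℕ => (y : ℝ))
    (M := fun q => ∑' y : ℕ, (y : ℝ) ^ q * nbPMF θ (Real.exp t) y)
    (nbPMF_nonneg hθ (Real.exp_pos t)) (fun y => y.cast_nonneg)
    (fun q => by
      rcases q.eq_zero_or_pos with rfl | hq
      · simpa using hpmf.summable.hasSum
      · exact (hC t ht q hq).1.hasSum)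
    (by simpa using hpmf.tsum_eq) (fun q hq => (hC t ht q hq).2) haC
  simp only [pow_one, hmean] at hS
  refine ⟨Real.exp (-(a * Real.exp t)) * S, ?_, (hsum.mul_left _).congr_fun fun y => ?_⟩
  · calc Real.exp (-(a * Real.exp t)) * S
        ≤ Real.exp (-(a * Real.exp t)) * Real.exp (a * Real.exp t + 2 * (a * C) ^ 2) := by gcongr
      _ = Real.exp (2 * (a * C) ^ 2) := by
          rw [← Real.exp_add]
          ring_nf
  · rw [← mul_assoc, ← Real.exp_add]
    ring_nf

/-- The law with linear predictor `0` has mean `1`. -/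
theorem IsMomentConstant.pos {θ R C : ℝ} (hC : IsMomentConstant θ R C) (hθ : 0 < θ)
    (hR : 0 ≤ R) : 0 < C := by
  have hmean := (hasSum_id_mul_nbPMF hθ (Real.exp_pos 0)).tsum_eq
  have hle := (hC 0 (by simpa using hR) 1 le_rfl).2
  simp only [pow_one, Nat.factorial_one, Nat.cast_one, one_mul] at hle
  rw [hmean, Real.exp_zero] at hle
  exact one_pos.trans_le hle

section ConditionalLaw

variable {Ω S : Type*} [MeasurableSpace Ω] [MeasurableSpace S] {P : Measure Ω}
  {X : Ω → S} {Y : Ω → ℕ} {w : Ω → ℕ → ℝ}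

theorem condDistrib_real_singleton_ae_eq [IsFiniteMeasure P] (hX : Measurable X)
    (hY : Measurable Y)
    (hw : ∀ y, P⟦Y ⁻¹' {y} | MeasurableSpace.comap X inferInstance⟧ =ᵐ[P] fun ω => w ω y) :
    ∀ᵐ ω ∂P, ∀ y, (condDistrib Y X P (X ω)).real {y} = w ω y :=
  ae_all_iff.mpr fun y =>
    (condDistrib_ae_eq_condExp hX hY (measurableSet_singleton y)).trans (hw y)

theorem lintegral_comp_eq_lintegral_tsum [IsFiniteMeasure P] (hX : Measurable X)
    (hY : Measurable Y)
    (hw : ∀ y, P⟦Y ⁻¹' {y} | MeasurableSpace.comap X inferInstance⟧ =ᵐ[P] fun ω => w ω y)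
    {g : S × ℕ → ENNReal} (hg : Measurable g) :
    ∫⁻ ω, g (X ω, Y ω) ∂P = ∫⁻ ω, ∑' y, g (X ω, y) * ENNReal.ofReal (w ω y) ∂P := by
  rw [← lintegral_map hg (hX.prodMk hY), ← compProd_map_condDistrib hY.aemeasurable,
    Measure.lintegral_compProd hg, lintegral_map hg.lintegral_kernel_prod_right' hX]
  refine lintegral_congr_ae ((condDistrib_real_singleton_ae_eq hX hY hw).mono fun ω hω => ?_)
  exact (lintegral_countable' _).trans (tsum_congr fun y => by rw [← hω, ofReal_measureReal])

theorem integral_comp_le_of_hasSum_le [IsProbabilityMeasure P] (hX : Measurable X)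
    (hY : Measurable Y)
    (hw : ∀ y, P⟦Y ⁻¹' {y} | MeasurableSpace.comap X inferInstance⟧ =ᵐ[P] fun ω => w ω y)
    {g : S × ℕ → ℝ} (hg : Measurable g) (hg0 : ∀ z, 0 ≤ g z) {c : ℝ}
    (hc : ∀ᵐ ω ∂P, ∃ s ≤ c, HasSum (fun y => g (X ω, y) * w ω y) s) :
    Integrable (fun ω => g (X ω, Y ω)) P ∧ ∫ ω, g (X ω, Y ω) ∂P ≤ c := by
  have hterm : ∀ᵐ ω ∂P, ∀ y, 0 ≤ g (X ω, y) * w ω y :=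
    (condDistrib_real_singleton_ae_eq hX hY hw).mono fun ω hω y =>
      mul_nonneg (hg0 _) (hω y ▸ measureReal_nonneg)
  have hc0 : 0 ≤ c := by
    obtain ⟨ω, hω, s, hsc, hs⟩ := (hterm.and hc).exists
    exact (hs.nonneg hω).trans hsc
  have hmeas : AEStronglyMeasurable (fun ω => g (X ω, Y ω)) P :=
    (hg.comp (hX.prodMk hY)).aestronglyMeasurable
  have hnonneg : 0 ≤ᵐ[P] fun ω => g (X ω, Y ω) := ae_of_all _ fun _ => hg0 _
  have hle : ∫⁻ ω, ENNReal.ofReal (g (X ω, Y ω)) ∂P ≤ ENNReal.ofReal c := by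
    rw [lintegral_comp_eq_lintegral_tsum hX hY hw hg.ennreal_ofReal]
    calc ∫⁻ ω, ∑' y, ENNReal.ofReal (g (X ω, y)) * ENNReal.ofReal (w ω y) ∂P
        ≤ ∫⁻ _, ENNReal.ofReal c ∂P := by
          refine lintegral_mono_ae ((hterm.and hc).mono fun ω ⟨hω, s, hsc, hs⟩ => ?_)
          simp only [← ENNReal.ofReal_mul (hg0 _)]
          rw [← ENNReal.ofReal_tsum_of_nonneg hω hs.summable, hs.tsum_eq]
          exact ENNReal.ofReal_le_ofReal hsc
      _ = ENNReal.ofReal c := by simp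
  refine ⟨⟨hmeas, ?_⟩, ?_⟩
  · rw [hasFiniteIntegral_iff_ofReal hnonneg]
    exact hle.trans_lt ENNReal.ofReal_lt_top
  · rw [integral_eq_lintegral_of_nonneg_ae hnonneg hmeas]
    exact ENNReal.toReal_le_of_le_ofReal hc0 hle

theorem condExp_comp_ae_eq_of_hasSum [IsFiniteMeasure P] (hX : Measurable X)
    (hY : Measurable Y)
    (hw : ∀ y, P⟦Y ⁻¹' {y} | MeasurableSpace.comap X inferInstance⟧ =ᵐ[P] fun ω => w ω y)
    {g : S × ℕ → ℝ} (hg : Measurable g) (hint : Integrable (fun ω => g (X ω, Y ω)) P)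
    {G : Ω → ℝ} (hG : ∀ᵐ ω ∂P, HasSum (fun y => g (X ω, y) * w ω y) (G ω)) :
    P[fun ω => g (X ω, Y ω) | MeasurableSpace.comap X inferInstance] =ᵐ[P] G := by
  have hmap : Integrable g (P.map fun ω => (X ω, Y ω)) :=
    (integrable_map_measure hg.aestronglyMeasurable (hX.prodMk hY).aemeasurable).mpr hint
  refine (condExp_prod_ae_eq_integral_condDistrib' hX hY.aemeasurable hmap).trans ?_
  filter_upwards [hmap.condDistrib_ae hX.aemeasurable hY.aemeasurable,
    condDistrib_real_singleton_ae_eq hX hY hw, hG] with ω hintω hwω hGω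
  rw [integral_countable hintω, ← hGω.tsum_eq]
  exact tsum_congr fun y => by rw [hwω, smul_eq_mul, mul_comm]

end ConditionalLaw

/-- The moment generating function of `Z` is at most that of a centred Gaussian variable of
standard deviation `2 b`, on the interval `[-1 / (2 b), 1 / (2 b)]`. This is the sub-exponential
bound that enters Bernstein's inequality. -/
def HasSubexpMGF {Ω : Type*} [MeasurableSpace Ω] (P : Measure Ω) (Z : Ω → ℝ) (b : ℝ) : Prop :=
  ∀ s : ℝ, |s| * b ≤ 1 / 2 →
    Integrable (fun ω => Real.exp (s * Z ω)) P ∧ mgf Z P s ≤ Real.exp (2 * (s * b) ^ 2)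

section Concentration

variable {Ω ι : Type*} [MeasurableSpace Ω] {P : Measure Ω} [Fintype ι]

theorem HasSubexpMGF.neg {Z : Ω → ℝ} {b : ℝ} (hZ : HasSubexpMGF P Z b) :
    HasSubexpMGF P (-Z) b := fun s hs => by
  simpa [mgf_neg] using hZ (-s) (by rwa [abs_neg])

theorem measureReal_sum_ge_le_exp {Z : ι → Ω → ℝ} (hindep : iIndepFun Z P)
    (hmeas : ∀ i, Measurable (Z i)) {b : ℝ} (hZ : ∀ i, HasSubexpMGF P (Z i) b) {s : ℝ}
    (hs : 0 ≤ s) (hsb : s * b ≤ 1 / 2) (c : ℝ) :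
    P.real {ω | c ≤ ∑ i, Z i ω} ≤ Real.exp (-s * c + Fintype.card ι * (2 * (s * b) ^ 2)) := by
  have := hindep.isProbabilityMeasure
  have hmgf := fun i => hZ i s (by rwa [abs_of_nonneg hs])
  have hchernoff := measure_ge_le_exp_mul_mgf (μ := P) c hs
    (hindep.integrable_exp_mul_sum hmeas (s := Finset.univ) fun i _ => (hmgf i).1)
  simp only [Finset.sum_apply] at hchernoff
  refine hchernoff.trans ?_
  rw [hindep.mgf_sum hmeas, Real.exp_add]
  gcongr
  calc ∏ i, mgf (Z i) P s ≤ ∏ _i : ι, Real.exp (2 * (s * b) ^ 2) :=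
        Finset.prod_le_prod (fun i _ => mgf_nonneg) fun i _ => (hmgf i).2
    _ = Real.exp (Fintype.card ι * (2 * (s * b) ^ 2)) := by simp [Real.exp_nat_mul]

/-- The hypotheses `hlin` and `hquad` are the exponential and the Gaussian regime of Bernstein's
inequality. -/
theorem measureReal_sum_ge_le_exp_neg {Z : ι → Ω → ℝ} (hindep : iIndepFun Z P)
    (hmeas : ∀ i, Measurable (Z i)) {b t u : ℝ} (hb : 0 < b)
    (hZ : ∀ i, HasSubexpMGF P (Z i) b) (ht : 0 ≤ t) (hlin : 4 * b * u ≤ t)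
    (hquad : 8 * b ^ 2 * u ≤ t ^ 2) :
    P.real {ω | Fintype.card ι * t ≤ ∑ i, Z i ω} ≤ Real.exp (-(Fintype.card ι * u)) := by
  -- the Chernoff exponent `t / (4 b²)` is optimal, and is truncated at `1 / (2 b)`
  obtain ⟨s, hs, hsb, hsu⟩ : ∃ s, 0 ≤ s ∧ s * b ≤ 1 / 2 ∧ u ≤ s * t - 2 * (s * b) ^ 2 := by
    rcases le_total t (2 * b) with htb | htb
    · refine ⟨t / (4 * b ^ 2), by positivity, ?_, ?_⟩
      · rw [div_mul_eq_mul_div, div_le_iff₀ (by positivity)]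
        nlinarith
      · calc u ≤ t ^ 2 / (8 * b ^ 2) := by
              rw [le_div_iff₀ (by positivity)]
              linarith
          _ = t / (4 * b ^ 2) * t - 2 * (t / (4 * b ^ 2) * b) ^ 2 := by
              field_simp
              ring
    · refine ⟨1 / (2 * b), by positivity, by field_simp; norm_num, ?_⟩
      calc u ≤ t / (4 * b) := by
            rw [le_div_iff₀ (by positivity)]
            linarith
        _ ≤ t / (2 * b) - 1 / 2 := by
            rw [div_sub_div _ _ (by positivity) two_ne_zero, div_le_div_iff₀ (by positivity)
              (by positivity)]
            nlinarith
        _ = 1 / (2 * b) * t - 2 * (1 / (2 * b) * b) ^ 2 := by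
            field_simp
  refine (measureReal_sum_ge_le_exp hindep hmeas hZ hs hsb _).trans (Real.exp_le_exp.mpr ?_)
  have := mul_le_mul_of_nonneg_left hsu (Nat.cast_nonneg (α := ℝ) (Fintype.card ι))
  linarith

theorem measureReal_abs_sum_ge_le_two_mul_exp_neg {Z : ι → Ω → ℝ} (hindep : iIndepFun Z P)
    (hmeas : ∀ i, Measurable (Z i)) {b t u : ℝ} (hb : 0 < b)
    (hZ : ∀ i, HasSubexpMGF P (Z i) b) (ht : 0 ≤ t) (hlin : 4 * b * u ≤ t)
    (hquad : 8 * b ^ 2 * u ≤ t ^ 2) :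
    P.real {ω | Fintype.card ι * t ≤ |∑ i, Z i ω|} ≤ 2 * Real.exp (-(Fintype.card ι * u)) := by
  have := hindep.isProbabilityMeasure
  have hupper := measureReal_sum_ge_le_exp_neg hindep hmeas hb hZ ht hlin hquad
  have hlower := measureReal_sum_ge_le_exp_neg (hindep.comp (fun _ => Neg.neg) fun _ =>
    measurable_neg) (fun i => (hmeas i).neg) hb (fun i => (hZ i).neg) ht hlin hquad
  simp only [Function.comp_apply, Finset.sum_neg_distrib] at hlower
  simp only [le_abs]
  exact (measureReal_union_le _ _).trans ((add_le_add hupper hlower).trans_eq (two_mul _).symm)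

theorem measureReal_abs_sum_ge_le_div_sq {Z : ι → Ω → ℝ} (hindep : iIndepFun Z P)
    (hL2 : ∀ i, MemLp (Z i) 2 P) (hmean : ∀ i, ∫ ω, Z i ω ∂P = 0) {v c : ℝ}
    (hv : ∀ i, ∫ ω, Z i ω ^ 2 ∂P ≤ v) (hc : 0 < c) :
    P.real {ω | c ≤ |∑ i, Z i ω|} ≤ Fintype.card ι * v / c ^ 2 := by
  have := hindep.isProbabilityMeasure
  have hzero : ∫ ω, ∑ i, Z i ω ∂P = 0 := by
    rw [integral_finsetSum _ fun i _ => (hL2 i).integrable one_le_two]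
    simp [hmean]
  have hvar : Var[∑ i, Z i; P] ≤ Fintype.card ι * v := by
    rw [IndepFun.variance_sum (fun i _ => hL2 i) fun i _ j _ hij => hindep.indepFun hij]
    calc ∑ i, Var[Z i; P] ≤ ∑ _i : ι, v := Finset.sum_le_sum fun i _ => by
          rw [variance_of_integral_eq_zero (hL2 i).1.aemeasurable (hmean i)]
          exact hv i
      _ = Fintype.card ι * v := by simp
  have hchebyshev := meas_ge_le_variance_div_sq (memLp_finsetSum' Finset.univ fun i _ => hL2 i) hc
  simp only [Finset.sum_apply, hzero, sub_zero] at hchebyshev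
  refine (ENNReal.toReal_le_of_le_ofReal (div_nonneg (variance_nonneg _ _) (sq_nonneg _))
    hchebyshev).trans ?_
  gcongr

end Concentration

/-- Independent negative binomial regression: given `Xᵢ`, the response `Yᵢ` is negative binomial
with dispersion `θ` and mean `exp (Xᵢᵀ βs)`. -/
structure NBRegression {Ω : Type u} [MeasurableSpace Ω] (P : Measure Ω) {n p : ℕ}
    (X : Fin n → Ω → Fin p → ℝ) (Y : Fin n → Ω → ℕ) (βs : Fin p → ℝ) (θ : ℝ) : Prop where
  measurable_X : ∀ i, Measurable (X i)
  measurable_Y : ∀ i, Measurable (Y i)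
  indep : iIndepFun (fun i ω => (X i ω, Y i ω)) P
  condLaw : ∀ i (y : ℕ),
    P⟦Y i ⁻¹' {y} | MeasurableSpace.comap (X i) inferInstance⟧
      =ᵐ[P] fun ω => nbPMF θ (Real.exp (X i ω ⬝ᵥ βs)) y

/-- The squared residual of one observation minus its conditional expectation. -/
noncomputable def sqResidualDev {p : ℕ} (θ : ℝ) (βs : Fin p → ℝ) (z : (Fin p → ℝ) × ℕ) : ℝ :=
  ((z.2 : ℝ) - Real.exp (z.1 ⬝ᵥ βs)) ^ 2 - nbVariance θ (Real.exp (z.1 ⬝ᵥ βs))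

section Regression

variable {n p : ℕ} {βs : Fin p → ℝ} {θ : ℝ}

theorem nbVariance_pos {m : ℝ} (hθ : 0 < θ) (hm : 0 < m) : 0 < nbVariance θ m := by
  unfold nbVariance
  positivity

theorem nbVariance_exp_le_of_abs_le {η R : ℝ} (hθ : 0 < θ) (hη : |η| ≤ R) :
    nbVariance θ (Real.exp η) ≤ nbVariance θ (Real.exp R) := by
  have := Real.exp_le_exp.mpr (le_of_abs_le hη)
  unfold nbVariance
  gcongr

@[fun_prop]
theorem measurable_sqResidualDev : Measurable (sqResidualDev θ βs) := by
  unfold sqResidualDev nbVariance dotProduct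
  fun_prop

end Regression

namespace NBRegression

variable {Ω : Type u} [MeasurableSpace Ω] {P : Measure Ω} {n p : ℕ} {X : Fin n → Ω → Fin p → ℝ}
  {Y : Fin n → Ω → ℕ} {βs : Fin p → ℝ} {θ R C : ℝ}

/-- Conditionally on the covariates, a weighted residual has the moment generating function of a
centred negative binomial variable. -/
theorem hasSubexpMGF_mul_residual (H : NBRegression P X Y βs θ) (hθ : 0 < θ)
    (hC : IsMomentConstant θ R C) {i : Fin n} (hR : ∀ᵐ ω ∂P, |X i ω ⬝ᵥ βs| ≤ R)
    {a : (Fin p → ℝ) → ℝ} (ha : Measurable a) {c : ℝ} (hac : ∀ᵐ ω ∂P, |a (X i ω)| ≤ c) :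
    HasSubexpMGF P (fun ω => a (X i ω) * ((Y i ω : ℝ) - Real.exp (X i ω ⬝ᵥ βs))) (c * C) := by
  intro s hs
  have := H.indep.isProbabilityMeasure
  refine integral_comp_le_of_hasSum_le (H.measurable_X i) (H.measurable_Y i) (H.condLaw i)
    (g := fun z => Real.exp (s * (a z.1 * ((z.2 : ℝ) - Real.exp (z.1 ⬝ᵥ βs)))))
    (by unfold dotProduct; fun_prop) (fun z => (Real.exp_pos _).le) ?_
  filter_upwards [hR, hac] with ω hη haω
  have hC0 : 0 < C := hC.pos hθ ((abs_nonneg _).trans hη)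
  have hscale : |s * a (X i ω)| * C ≤ |s| * (c * C) := by
    rw [abs_mul, mul_assoc]
    gcongr
  obtain ⟨S, hS, hsum⟩ := hC.exists_hasSum_exp_mul_sub_le hθ hη (hscale.trans hs)
  refine ⟨S, hS.trans (Real.exp_le_exp.mpr ?_), by simpa only [mul_assoc] using hsum⟩
  have hsq : (s * a (X i ω) * C) ^ 2 ≤ (s * (c * C)) ^ 2 := by
    rw [← sq_abs (s * a (X i ω) * C), ← sq_abs (s * (c * C)), abs_mul _ C, abs_of_pos hC0]
    gcongr
    exact hscale.trans (by rw [abs_mul]; gcongr; exact le_abs_self _)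
  linarith

theorem measureReal_abs_mean_score_gt_le (H : NBRegression P X Y βs θ) (hθ : 0 < θ) (hn : 0 < n)
    (hC : IsMomentConstant θ R C) (hR : ∀ i, ∀ᵐ ω ∂P, |X i ω ⬝ᵥ βs| ≤ R) {L : ℝ}
    {j : Fin p} (hL : ∀ i, ∀ᵐ ω ∂P, |X i ω j| ≤ L) {t u : ℝ} (hLC : 0 < L * C) (ht : 0 ≤ t)
    (hlin : 4 * (L * C) * u ≤ t) (hquad : 8 * (L * C) ^ 2 * u ≤ t ^ 2) :
    P.real {ω | t < |(1 / (n : ℝ)) * ∑ i, nbScore θ (Y i ω) (X i ω ⬝ᵥ βs) * X i ω j|}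
      ≤ 2 * Real.exp (-(n * u)) := by
  have := H.indep.isProbabilityMeasure
  let a : (Fin p → ℝ) → ℝ := fun x => θ / (θ + Real.exp (x ⬝ᵥ βs)) * x j
  let F : (Fin p → ℝ) × ℕ → ℝ := fun z => a z.1 * ((z.2 : ℝ) - Real.exp (z.1 ⬝ᵥ βs))
  have ha : Measurable a := by
    unfold a dotProduct
    fun_prop
  have hF : Measurable F := by
    unfold F dotProduct
    fun_prop
  have hsubexp : ∀ i, HasSubexpMGF P (fun ω => F (X i ω, Y i ω)) (L * C) := fun i => by
    refine H.hasSubexpMGF_mul_residual hθ hC (hR i) ha ((hL i).mono fun ω hω => ?_)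
    have hle : θ / (θ + Real.exp (X i ω ⬝ᵥ βs)) ≤ 1 := by
      rw [div_le_one (by positivity)]
      linarith [Real.exp_pos (X i ω ⬝ᵥ βs)]
    rw [abs_mul, abs_of_pos (by positivity)]
    exact (mul_le_of_le_one_left (abs_nonneg _) hle).trans hω
  have hbernstein := measureReal_abs_sum_ge_le_two_mul_exp_neg
    (H.indep.comp (fun _ => F) fun _ => hF)
    (fun i => hF.comp ((H.measurable_X i).prodMk (H.measurable_Y i))) hLC hsubexp ht hlin hquad
  rw [Fintype.card_fin] at hbernstein
  refine (measureReal_mono fun ω hω => ?_).trans hbernstein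
  have hscore : ∑ i, nbScore θ (Y i ω) (X i ω ⬝ᵥ βs) * X i ω j = ∑ i, F (X i ω, Y i ω) :=
    Finset.sum_congr rfl fun i _ => by
      simp only [nbScore, F, a]
      ring
  rw [Set.mem_ofPred_eq, hscore, abs_mul, abs_of_nonneg (by positivity), one_div,
    lt_inv_mul_iff₀ (by exact_mod_cast hn)] at hω
  exact hω.le

theorem integral_sqResidualDev_sq_le (H : NBRegression P X Y βs θ) (hθ : 0 < θ) {i : Fin n}
    (hR : ∀ᵐ ω ∂P, |X i ω ⬝ᵥ βs| ≤ R) :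
    Integrable (fun ω => sqResidualDev θ βs (X i ω, Y i ω) ^ 2) P ∧
      ∫ ω, sqResidualDev θ βs (X i ω, Y i ω) ^ 2 ∂P
        ≤ (2 + 6 / θ) * nbVariance θ (Real.exp R) ^ 2 + nbVariance θ (Real.exp R) := by
  have := H.indep.isProbabilityMeasure
  refine integral_comp_le_of_hasSum_le (H.measurable_X i) (H.measurable_Y i) (H.condLaw i)
    (g := fun z => sqResidualDev θ βs z ^ 2) (by fun_prop) (fun z => sq_nonneg _) ?_
  filter_upwards [hR] with ω hη
  have hmoment := hasSum_sq_sub_variance_sq_mul_nbPMF hθ (Real.exp_pos (X i ω ⬝ᵥ βs))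
  refine ⟨_, ?_, hmoment⟩
  have := nbVariance_exp_le_of_abs_le hθ hη
  have := nbVariance_pos hθ (Real.exp_pos (X i ω ⬝ᵥ βs))
  gcongr

theorem integral_sqResidualDev (H : NBRegression P X Y βs θ) (hθ : 0 < θ) {i : Fin n}
    (hint : Integrable (fun ω => sqResidualDev θ βs (X i ω, Y i ω)) P) :
    ∫ ω, sqResidualDev θ βs (X i ω, Y i ω) ∂P = 0 := by
  have := H.indep.isProbabilityMeasure
  have hcond := condExp_comp_ae_eq_of_hasSum (H.measurable_X i) (H.measurable_Y i) (H.condLaw i)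
    measurable_sqResidualDev hint (G := fun _ => 0) (ae_of_all _ fun ω => by
      have hm := Real.exp_pos (X i ω ⬝ᵥ βs)
      simpa [sqResidualDev, sub_mul] using (hasSum_sub_sq_mul_nbPMF hθ hm).sub
        ((hasSum_nbPMF hθ hm).mul_left (nbVariance θ (Real.exp (X i ω ⬝ᵥ βs)))))
  rw [← integral_condExp (H.measurable_X i).comap_le, integral_congr_ae hcond, integral_zero]

theorem measureReal_mean_sq_residual_gt_le (H : NBRegression P X Y βs θ) (hθ : 0 < θ)
    (hn : 0 < n) (hR : ∀ i, ∀ᵐ ω ∂P, |X i ω ⬝ᵥ βs| ≤ R) {E : ℝ} (hE : 0 < E) :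
    P.real {ω | E + nbVariance θ (Real.exp R)
        < (1 / (n : ℝ)) * ∑ i, ((Y i ω : ℝ) - Real.exp (X i ω ⬝ᵥ βs)) ^ 2}
      ≤ ((2 + 6 / θ) * nbVariance θ (Real.exp R) ^ 2 + nbVariance θ (Real.exp R))
        / (n * E ^ 2) := by
  have := H.indep.isProbabilityMeasure
  have hn' : (0 : ℝ) < n := by exact_mod_cast hn
  have hL2 : ∀ i, MemLp (fun ω => sqResidualDev θ βs (X i ω, Y i ω)) 2 P := fun i =>
    (memLp_two_iff_integrable_sq (measurable_sqResidualDev.comp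
      ((H.measurable_X i).prodMk (H.measurable_Y i))).aestronglyMeasurable).mpr
      (H.integral_sqResidualDev_sq_le hθ (hR i)).1
  have hchebyshev := measureReal_abs_sum_ge_le_div_sq
    (H.indep.comp (fun _ => sqResidualDev θ βs) fun _ => measurable_sqResidualDev) hL2
    (fun i => H.integral_sqResidualDev hθ ((hL2 i).integrable one_le_two))
    (fun i => (H.integral_sqResidualDev_sq_le hθ (hR i)).2) (c := n * E) (by positivity)
  rw [Fintype.card_fin, mul_pow, sq (n : ℝ), mul_assoc, mul_div_mul_left _ _ hn'.ne']
    at hchebyshev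
  refine (ENNReal.toReal_mono (measure_ne_top _ _) (measure_mono_ae ?_)).trans hchebyshev
  filter_upwards [ae_all_iff.mpr hR] with ω hη (hω : _ < _)
  have hV : ∑ i, nbVariance θ (Real.exp (X i ω ⬝ᵥ βs)) ≤ n * nbVariance θ (Real.exp R) := by
    simpa using Finset.sum_le_card_nsmul Finset.univ _ _ fun i _ =>
      nbVariance_exp_le_of_abs_le hθ (hη i)
  rw [one_div, lt_inv_mul_iff₀ hn'] at hω
  refine le_trans (b := ∑ i, sqResidualDev θ βs (X i ω, Y i ω)) ?_ (le_abs_self _)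
  simp only [sqResidualDev, Finset.sum_sub_distrib]
  linarith

end NBRegression

/-- The regression model of the grouping inequality, with its bounds and tuning parameters. The two
lower bounds for `λ₁` are what Bernstein's inequality requires for the gradient of the loss to be
at most `λ₁ / 2` with high probability. -/
structure GroupingHypotheses {Ω : Type u} [MeasurableSpace Ω] (P : Measure Ω) {n p : ℕ}
    (X : Fin n → Ω → Fin p → ℝ) (Y : Fin n → Ω → ℕ) (βs : Fin p → ℝ)
    (θ L B A C lam1 lam2 : ℝ) : Prop extends NBRegression P X Y βs θ where
  n_pos : 0 < n
  p_pos : 0 < p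
  bounded_X : ∀ i, ∀ᵐ ω ∂P, ∀ j, |X i ω j| ≤ L
  bounded_beta : ∀ j, |βs j| ≤ B
  bounded_predictor : ∀ i, ∀ᵐ ω ∂P, |X i ω ⬝ᵥ βs| ≤ L * B
  one_lt_A : 1 < A
  momentConstant : IsMomentConstant θ (L * B) C
  lam1_ge_linear : 8 * A ^ 2 * L * C * (Real.log (2 * (p : ℝ)) / (n : ℝ)) ≤ lam1
  lam1_ge_sqrt : 4 * √2 * A * L * C * √(Real.log (2 * (p : ℝ)) / (n : ℝ)) ≤ lam1
  lam2_eq : lam2 = lam1 / (8 * B)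

theorem log_two_mul_div_pos {n p : ℕ} (hn : 0 < n) (hp : 0 < p) :
    0 < Real.log (2 * (p : ℝ)) / (n : ℝ) := by
  have hp' : (1 : ℝ) ≤ p := by exact_mod_cast hp
  have := Real.log_pos (x := 2 * (p : ℝ)) (by linarith)
  positivity

theorem OracleHypotheses.groupingHypotheses {Ω : Type u} [MeasurableSpace Ω] {P : Measure Ω}
    {n p : ℕ} {X : Fin n → Ω → Fin p → ℝ} {Y : Fin n → Ω → ℕ} {βs : Fin p → ℝ}
    {θ L B κ A C ε lam1 lam2 : ℝ} (H : OracleHypotheses P X Y βs θ L B κ A C ε lam1 lam2)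
    (hθ : 0 < θ) (hL : 0 < L) (hB : 0 < B) :
    GroupingHypotheses P X Y βs θ L B A C lam1 lam2 := by
  have hC : 0 < C := H.momentConstant.pos hθ (by positivity)
  have hA : 0 < A := one_pos.trans H.one_lt_A
  have hr := log_two_mul_div_pos H.n_pos H.p_pos
  have hlam1 := max_le_iff.mp H.lam1_ge
  have hsqrt := (max_le_iff.mp hlam1.2).1
  exact
    { H with
      lam1_ge_linear := le_trans (by gcongr; norm_num) hlam1.1
      lam1_ge_sqrt := le_trans (by gcongr; norm_num) hsqrt }

namespace GroupingHypotheses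

variable {Ω : Type u} [MeasurableSpace Ω] {P : Measure Ω} {n p : ℕ} {X : Fin n → Ω → Fin p → ℝ}
  {Y : Fin n → Ω → ℕ} {βs : Fin p → ℝ} {θ L B A C E lam1 lam2 : ℝ}

theorem lam1_pos (H : GroupingHypotheses P X Y βs θ L B A C lam1 lam2) (hθ : 0 < θ)
    (hL : 0 < L) (hB : 0 < B) : 0 < lam1 := by
  have hC : 0 < C := H.momentConstant.pos hθ (by positivity)
  have hA : 0 < A := one_pos.trans H.one_lt_A
  have hr := log_two_mul_div_pos H.n_pos H.p_pos
  exact lt_of_lt_of_le (by positivity) H.lam1_ge_linear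

theorem lam2_pos (H : GroupingHypotheses P X Y βs θ L B A C lam1 lam2) (hθ : 0 < θ)
    (hL : 0 < L) (hB : 0 < B) : 0 < lam2 := by
  rw [H.lam2_eq]
  exact div_pos (H.lam1_pos hθ hL hB) (by positivity)

theorem measureReal_gradient_gt_le (H : GroupingHypotheses P X Y βs θ L B A C lam1 lam2)
    (hθ : 0 < θ) (hL : 0 < L) (hB : 0 < B) (j : Fin p) :
    P.real {ω | lam1 / 2 < |(1 / (n : ℝ)) * ∑ i, nbScore θ (Y i ω) (X i ω ⬝ᵥ βs) * X i ω j|}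
      ≤ 2 * (2 * (p : ℝ)) ^ (-A ^ 2) := by
  have hC : 0 < C := H.momentConstant.pos hθ (by positivity)
  have hA : 0 < A := one_pos.trans H.one_lt_A
  have hr := log_two_mul_div_pos H.n_pos H.p_pos
  have hlam1 := H.lam1_pos hθ hL hB
  have hlinear := H.lam1_ge_linear
  have hn : (0 : ℝ) < n := by exact_mod_cast H.n_pos
  have hp : (0 : ℝ) < p := by exact_mod_cast H.p_pos
  have hquad : 32 * (L * C) ^ 2 * (A ^ 2 * (Real.log (2 * (p : ℝ)) / n)) ≤ lam1 ^ 2 :=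
    calc _ = (4 * √2 * A * L * C * √(Real.log (2 * (p : ℝ)) / n)) ^ 2 := by
          simp only [mul_pow, Real.sq_sqrt hr.le, Real.sq_sqrt zero_le_two]
          ring
      _ ≤ lam1 ^ 2 := by
          gcongr
          exact H.lam1_ge_sqrt
  have hexp : Real.exp (-(n * (A ^ 2 * (Real.log (2 * (p : ℝ)) / n))))
      = (2 * (p : ℝ)) ^ (-A ^ 2) := by
    rw [Real.rpow_def_of_pos (by positivity)]
    congr 1
    field_simp
  rw [← hexp]
  exact H.measureReal_abs_mean_score_gt_le hθ H.n_pos H.momentConstant H.bounded_predictor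
    (fun i => (H.bounded_X i).mono fun ω hω => hω j) (by positivity) (by positivity)
    (by linarith) (by linarith)

theorem measureReal_compl_isGoodSample_le
    (H : GroupingHypotheses P X Y βs θ L B A C lam1 lam2) (hθ : 0 < θ) (hL : 0 < L)
    (hB : 0 < B) (hE : 0 < E) :
    P.real {ω | IsGoodSample θ L B E lam1 (fun i => X i ω) (fun i => Y i ω) βs}ᶜ
      ≤ failureProb θ L B A E n p := by
  have := H.indep.isProbabilityMeasure
  have hp : (0 : ℝ) < p := by exact_mod_cast H.p_pos
  let score (j : Fin p) : Set Ω :=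
    {ω | lam1 / 2 < |(1 / (n : ℝ)) * ∑ i, nbScore θ (Y i ω) (X i ω ⬝ᵥ βs) * X i ω j|}
  let residual : Set Ω := {ω | E + nbVariance θ (Real.exp (L * B))
    < (1 / (n : ℝ)) * ∑ i, ((Y i ω : ℝ) - Real.exp (X i ω ⬝ᵥ βs)) ^ 2}
  have hscore : P.real (⋃ j, score j) ≤ (2 * (p : ℝ)) ^ (1 - A ^ 2) := by
    calc P.real (⋃ j, score j) ≤ ∑ j, P.real (score j) := measureReal_iUnion_fintype_le _
      _ ≤ ∑ _j : Fin p, 2 * (2 * (p : ℝ)) ^ (-A ^ 2) :=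
          Finset.sum_le_sum fun j _ => H.measureReal_gradient_gt_le hθ hL hB j
      _ = (2 * (p : ℝ)) ^ (1 - A ^ 2) := by
          rw [sub_eq_add_neg, Real.rpow_add (by positivity), Real.rpow_one, Finset.sum_const,
            Finset.card_univ, Fintype.card_fin, nsmul_eq_mul]
          ring
  have hresidual : P.real residual ≤ sqVarBound θ L B / (n * E ^ 2) :=
    H.measureReal_mean_sq_residual_gt_le hθ H.n_pos H.bounded_predictor hE
  have hcover : P.real {ω | IsGoodSample θ L B E lam1 (fun i => X i ω) (fun i => Y i ω) βs}ᶜ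
      ≤ P.real ((⋃ j, score j) ∪ residual) := by
    refine ENNReal.toReal_mono (measure_ne_top _ _) (measure_mono_ae ?_)
    filter_upwards [ae_all_iff.mpr H.bounded_X] with ω hX hbad
    by_contra hω
    obtain ⟨hgrad, hres⟩ := not_or.mp hω
    rw [Set.mem_iUnion, not_exists] at hgrad
    exact hbad ⟨hX, fun j => not_lt.mp (hgrad j), not_lt.mp hres⟩
  have hunion := measureReal_union_le (μ := P) (⋃ j, score j) residual
  have hpow : 0 < (2 * (p : ℝ)) ^ (1 - A ^ 2) := by positivity
  have hpow' : 0 < (2 * (p : ℝ)) ^ (-A ^ 2) := by positivity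
  unfold failureProb
  linarith

end GroupingHypotheses

theorem one_sub_le_measureReal_of_compl_subset {Ω : Type*} [MeasurableSpace Ω] {P : Measure Ω}
    [IsProbabilityMeasure P] {s t : Set Ω} {q : ℝ} (hs : P.real sᶜ ≤ q) (h : s ⊆ t) :
    1 - q ≤ P.real t := by
  have hcover := measureReal_union_le (μ := P) sᶜ s
  rw [Set.compl_union_self, probReal_univ] at hcover
  linarith [measureReal_mono (μ := P) h]

theorem tendsto_failureProb (θ L B : ℝ) {A : ℝ} (hA : 1 < A) {E : ℝ} (hE : 0 < E) {n p : ℕ → ℕ}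
    (hn : Tendsto n atTop atTop) (hp : Tendsto p atTop atTop) :
    Tendsto (fun r => failureProb θ L B A E (n r) (p r)) atTop (𝓝 0) := by
  have hp' : Tendsto (fun r => 2 * (p r : ℝ)) atTop atTop :=
    (tendsto_natCast_atTop_atTop.comp hp).const_mul_atTop (by norm_num)
  have hn' : Tendsto (fun r => (n r : ℝ) * E ^ 2) atTop atTop :=
    (tendsto_natCast_atTop_atTop.comp hn).atTop_mul_const (by positivity)
  have hpow : ∀ {a : ℝ}, a < 0 → Tendsto (fun r => (2 * (p r : ℝ)) ^ a) atTop (𝓝 0) := fun {a} ha =>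
    by simpa only [Function.comp_def, neg_neg] using
      (tendsto_rpow_neg_atTop (neg_pos.mpr ha)).comp hp'
  have hdiv : Tendsto (fun r => sqVarBound θ L B / ((n r : ℝ) * E ^ 2)) atTop (𝓝 0) :=
    tendsto_const_nhds.div_atTop hn'
  have hsum := ((hpow (a := 1 - A ^ 2) (by nlinarith)).const_mul 2).add
    (hpow (a := -A ^ 2) (by nlinarith)) |>.add hdiv
  simpa only [failureProb, mul_zero, add_zero] using hsum

theorem lt_abs_div_sq_of_sq_le {w lam G V c δ d : ℝ} (hw : 0 ≤ w) (hlam : 0 < lam) (hG : 0 ≤ G)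
    (hV : 0 < V) (hc : lam ^ 2 ≤ c) (hδ : 0 ≤ δ) (hd : δ < |d|)
    (hle : |d| ^ 2 ≤ 1 / 2 * w * (G + 1 / lam ^ 2 * V)) :
    2 * δ ^ 2 / (c * G + V) < |w / lam ^ 2| := by
  have hc0 : 0 ≤ c := (sq_nonneg lam).trans hc
  rw [abs_of_nonneg (by positivity), div_lt_iff₀ (by positivity)]
  calc 2 * δ ^ 2 < 2 * |d| ^ 2 := by gcongr
    _ ≤ 2 * (1 / 2 * w * (G + 1 / lam ^ 2 * V)) := by gcongr
    _ = w / lam ^ 2 * (lam ^ 2 * G + V) := by field_simp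
    _ ≤ w / lam ^ 2 * (c * G + V) := by gcongr

namespace GroupingHypotheses

variable {Ω : Type u} [MeasurableSpace Ω] {P : Measure Ω} {n p D : ℕ} {X : Fin n → Ω → Fin p → ℝ}
  {Y : Fin n → Ω → ℕ} {βs : Fin p → ℝ} {βhat : Ω → Fin p → ℝ} {θ L B A C E lam1 lam2 : ℝ}

theorem measureReal_abs_sub_gt_le (H : GroupingHypotheses P X Y βs θ L B A C lam1 lam2)
    (hθ : 0 < θ) (hL : 0 < L) (hB : 0 < B) (hD : (coefSupport βs).card ≤ D)
    (hβ : ∀ ω, IsElasticNet θ lam1 lam2 (fun i => X i ω) (fun i => Y i ω) (βhat ω))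
    (hE : 0 < E) {c δ : ℝ} (hc : lam2 ^ 2 ≤ c) (hδ : 0 ≤ δ) (k l : Fin p) :
    P.real {ω | Standardized (fun i => X i ω) ∧ δ < |βhat ω k - βhat ω l|}
      ≤ P.real {ω | Standardized (fun i => X i ω) ∧
          2 * δ ^ 2 / (c * groupConst θ L B D + (E + varBound θ L B))
            < |(1 - empCorr (fun i => X i ω) k l) / lam2 ^ 2|}
        + failureProb θ L B A E n p := by
  have := H.indep.isProbabilityMeasure
  refine (measureReal_mono fun ω hω => ?_).trans ((measureReal_union_le _ _).trans
    (add_le_add_right (H.measureReal_compl_isGoodSample_le hθ hL hB hE) _))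
  refine or_iff_not_imp_right.mpr fun hgood => ⟨hω.1, ?_⟩
  have hV := varBound_pos hθ L B
  exact lt_abs_div_sq_of_sq_le (one_sub_empCorr_nonneg hω.1 k l) (H.lam2_pos hθ hL hB)
    (groupConst_nonneg hθ L B D) (by positivity) hc hδ hω.2
    ((hβ ω).grouping_oracle hθ hL.le hB hE.le (H.lam1_pos hθ hL hB) H.lam2_eq
      H.bounded_beta hD (not_not.mp hgood) hω.1 k l)

end GroupingHypotheses

theorem mainTheorem6_general (θ L B : ℝ) (D : ℕ) (hθ : 0 < θ) (hL : 0 < L) (hB : 0 < B) :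
    ∃ O1 : ℝ, 0 ≤ O1 ∧
      (∀ (Ω : Type u) (_ : MeasurableSpace Ω) (P : Measure Ω) (n p : ℕ)
          (X : Fin n → Ω → Fin p → ℝ) (Y : Fin n → Ω → ℕ) (βs : Fin p → ℝ)
          (βhat : Ω → Fin p → ℝ) (A C lam1 lam2 : ℝ),
        GroupingHypotheses P X Y βs θ L B A C lam1 lam2 →
        (coefSupport βs).card ≤ D →
        (∀ ω, IsElasticNet θ lam1 lam2 (fun i => X i ω) (fun i => Y i ω) (βhat ω)) →
        ∀ E : ℝ, 0 < E →
          1 - failureProb θ L B A E n p ≤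
            P.real {ω | Standardized (fun i => X i ω) → ∀ k l : Fin p,
              |βhat ω k - βhat ω l| ^ 2 ≤
                1 / 2 * (1 - empCorr (fun i => X i ω) k l) *
                  (O1 + 1 / lam2 ^ 2 * (E + varBound θ L B))}) ∧
      (∀ (Ω : ℕ → Type u) (_ : ∀ r, MeasurableSpace (Ω r)) (P : ∀ r, Measure (Ω r))
          (n p : ℕ → ℕ) (X : ∀ r, Fin (n r) → Ω r → Fin (p r) → ℝ)
          (Y : ∀ r, Fin (n r) → Ω r → ℕ) (βs : ∀ r, Fin (p r) → ℝ)
          (βhat : ∀ r, Ω r → Fin (p r) → ℝ) (A : ℝ) (C lam1 lam2 : ℕ → ℝ)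
          (k l : ∀ r, Fin (p r)),
        (∀ r, GroupingHypotheses (P r) (X r) (Y r) (βs r) θ L B A (C r) (lam1 r) (lam2 r)) →
        (∀ r, (coefSupport (βs r)).card ≤ D) →
        (∀ r ω, IsElasticNet θ (lam1 r) (lam2 r) (fun i => X r i ω) (fun i => Y r i ω)
          (βhat r ω)) →
        Tendsto n atTop atTop →
        Tendsto p atTop atTop →
        (fun r => lam2 r ^ 2) =O[atTop] (fun _ => (1 : ℝ)) →
        (∀ δ : ℝ, 0 < δ → Tendsto (fun r => (P r).real {ω | Standardized (fun i => X r i ω) ∧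
          δ < |(1 - empCorr (fun i => X r i ω) (k r) (l r)) / lam2 r ^ 2|}) atTop (𝓝 0)) →
        ∀ δ : ℝ, 0 < δ → Tendsto (fun r => (P r).real {ω | Standardized (fun i => X r i ω) ∧
          δ < |βhat r ω (k r) - βhat r ω (l r)|}) atTop (𝓝 0)) := by
  have hG := groupConst_nonneg hθ L B D
  refine ⟨groupConst θ L B D, hG, ?_, ?_⟩
  · intro Ω _ P n p X Y βs βhat A C lam1 lam2 H hD hβ E hE
    have := H.indep.isProbabilityMeasure
    exact one_sub_le_measureReal_of_compl_subset
      (H.measureReal_compl_isGoodSample_le hθ hL hB hE) fun ω hω hx =>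
        (hβ ω).grouping_oracle hθ hL.le hB hE.le (H.lam1_pos hθ hL hB) H.lam2_eq
          H.bounded_beta hD hω hx
  · intro Ω _ P n p X Y βs βhat A C lam1 lam2 k l H hD hβ hn hp hlam2 hR δ hδ
    obtain ⟨c, hc0, hc⟩ := hlam2.exists_pos
    have hV := varBound_pos hθ L B
    have hlim := (hR (2 * δ ^ 2 / (c * groupConst θ L B D + (1 + varBound θ L B)))
      (by positivity)).add (tendsto_failureProb θ L B (H 0).one_lt_A one_pos hn hp)
    rw [add_zero] at hlim
    refine tendsto_of_tendsto_of_tendsto_of_le_of_le' tendsto_const_nhds hlim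
      (Eventually.of_forall fun _ => measureReal_nonneg) ?_
    filter_upwards [hc.bound] with r hr
    rw [norm_one, mul_one] at hr
    exact (H r).measureReal_abs_sub_gt_le hθ hL hB (hD r) (hβ r) one_pos
      ((le_abs_self _).trans hr) hδ.le (k r) (l r)

theorem radiusM_nonneg {B ε : ℝ} (hB : 0 ≤ B) (hε : 0 ≤ ε) : 0 ≤ radiusM B ε := by
  unfold radiusM
  positivity

theorem one_le_exp_two_mul_mul_radiusM {L B ε : ℝ} (hL : 0 ≤ L) (hB : 0 ≤ B) (hε : 0 ≤ ε) :
    1 ≤ Real.exp (2 * L * radiusM B ε) :=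
  Real.one_le_exp (mul_nonneg (by positivity) (radiusM_nonneg hB hε))

theorem grouping_bound_le {n p : ℕ} {x : Fin n → Fin p → ℝ} {G V e : ℝ} (hn : 0 < n)
    (hx : Standardized x) (hG : 0 ≤ G) (he : 1 ≤ e) (k l : Fin p) :
    1 / 2 * (1 - empCorr x k l) * (G + V)
      ≤ 1 / 2 * (1 - empCorr x k l) * (maxEntry x * e * G + V) := by
  have hρ := one_sub_empCorr_nonneg hx k l
  have hK := one_le_maxEntry_of_standardized hn hx k
  gcongr
  exact le_mul_of_one_le_left hG (one_le_mul_of_one_le_of_one_le hK he)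

theorem abs_le_sqrt_of_sq_le {w lam G V e d : ℝ} (hw : 0 ≤ w) (hlam : 0 < lam) (hG : 0 ≤ G)
    (he : 1 ≤ e) (hle : |d| ^ 2 ≤ 1 / 2 * w * (G + 1 / lam ^ 2 * V)) :
    |d| ≤ √(1 / 2 * (w / lam ^ 2) * (lam ^ 2 * e * G + V)) := by
  refine Real.le_sqrt_of_sq_le ?_
  calc |d| ^ 2 ≤ 1 / 2 * w * (G + 1 / lam ^ 2 * V) := hle
    _ = 1 / 2 * (w / lam ^ 2) * (lam ^ 2 * 1 * G + V) := by field_simp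
    _ ≤ 1 / 2 * (w / lam ^ 2) * (lam ^ 2 * e * G + V) := by gcongr

theorem mainTheorem6 (θ L B κ : ℝ) (D : ℕ) (hθ : 0 < θ) (hL : 0 < L) (hB : 0 < B) :
    ∃ O1 : ℝ, 0 ≤ O1 ∧
      (∀ (Ω : Type u) (_ : MeasurableSpace Ω) (P : Measure Ω) (n p : ℕ)
          (X : Fin n → Ω → Fin p → ℝ) (Y : Fin n → Ω → ℕ) (βs : Fin p → ℝ)
          (βhat : Ω → Fin p → ℝ) (A C ε lam1 lam2 : ℝ),
        OracleHypotheses P X Y βs θ L B κ A C ε lam1 lam2 →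
        (coefSupport βs).card ≤ D →
        (∀ ω, IsElasticNet θ lam1 lam2 (fun i => X i ω) (fun i => Y i ω) (βhat ω)) →
        ∀ E : ℝ, 0 < E →
          1 - failureProb θ L B A E n p ≤
            P.real {ω | Standardized (fun i => X i ω) → ∀ k l : Fin p,
              |βhat ω k - βhat ω l| ^ 2 ≤
                1 / 2 * (1 - empCorr (fun i => X i ω) k l) *
                  (maxEntry (fun i => X i ω) * Real.exp (2 * L * radiusM B ε) * O1
                    + 1 / lam2 ^ 2 * (E + varBound θ L B))}) ∧
      (∀ (Ω : ℕ → Type u) (_ : ∀ r, MeasurableSpace (Ω r)) (P : ∀ r, Measure (Ω r))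
          (n p : ℕ → ℕ) (X : ∀ r, Fin (n r) → Ω r → Fin (p r) → ℝ)
          (Y : ∀ r, Fin (n r) → Ω r → ℕ) (βs : ∀ r, Fin (p r) → ℝ)
          (βhat : ∀ r, Ω r → Fin (p r) → ℝ) (A C : ℝ) (ε lam1 lam2 : ℕ → ℝ)
          (k l : ∀ r, Fin (p r)),
        (∀ r, OracleHypotheses (P r) (X r) (Y r) (βs r) θ L B κ A C (ε r) (lam1 r) (lam2 r)) →
        (∀ r, (coefSupport (βs r)).card ≤ D) →
        (∀ r ω, IsElasticNet θ (lam1 r) (lam2 r) (fun i => X r i ω) (fun i => Y r i ω)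
          (βhat r ω)) →
        Tendsto n atTop atTop →
        Tendsto p atTop atTop →
        (fun r => lam2 r ^ 2) =O[atTop] (fun r => Real.log (p r : ℝ) / (n r : ℝ)) →
        Tendsto (fun r => Real.log (p r : ℝ) / (n r : ℝ)) atTop (𝓝 0) →
        (∀ δ : ℝ, 0 < δ → Tendsto (fun r => (P r).real {ω | Standardized (fun i => X r i ω) ∧
          δ < |(1 - empCorr (fun i => X r i ω) (k r) (l r)) / lam2 r ^ 2|}) atTop (𝓝 0)) →
        (∀ E : ℝ, 0 < E → ∀ r,
          1 - failureProb θ L B A E (n r) (p r) ≤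
            (P r).real {ω | Standardized (fun i => X r i ω) →
              |βhat r ω (k r) - βhat r ω (l r)| ≤
                √(1 / 2 * ((1 - empCorr (fun i => X r i ω) (k r) (l r)) / lam2 r ^ 2) *
                  (lam2 r ^ 2 * Real.exp (2 * L * radiusM B (ε r)) * O1
                    + (E + varBound θ L B)))}) ∧
        (∀ δ : ℝ, 0 < δ → Tendsto (fun r => (P r).real {ω | Standardized (fun i => X r i ω) ∧
          δ < |βhat r ω (k r) - βhat r ω (l r)|}) atTop (𝓝 0))) := by
  obtain ⟨O1, hO1, hprob, hlim⟩ := mainTheorem6_general θ L B D hθ hL hB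
  refine ⟨O1, hO1, ?_, ?_⟩
  · intro Ω _ P n p X Y βs βhat A C ε lam1 lam2 H hD hβ E hE
    have := H.isProb
    have hexp := one_le_exp_two_mul_mul_radiusM hL.le hB.le H.eps_nonneg
    refine (hprob _ _ _ _ _ _ _ _ _ _ _ _ _ (H.groupingHypotheses hθ hL hB) hD hβ E hE).trans
      (measureReal_mono fun ω hω hx k l => ?_)
    exact (hω hx k l).trans (grouping_bound_le H.n_pos hx hO1 hexp k l)
  · intro Ω _ P n p X Y βs βhat A C ε lam1 lam2 k l H hD hβ hn hp hlam2 hlog hR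
    have HG := fun r => (H r).groupingHypotheses hθ hL hB
    refine ⟨fun E hE r => ?_, hlim _ _ _ _ _ _ _ _ _ _ _ _ _ k l HG hD hβ hn hp
      ((hlam2.trans_tendsto hlog).isBigO_one ℝ) hR⟩
    have := (H r).isProb
    have hexp := one_le_exp_two_mul_mul_radiusM hL.le hB.le (H r).eps_nonneg
    refine (hprob _ _ _ _ _ _ _ _ _ _ _ _ _ (HG r) (hD r) (hβ r) E hE).trans
      (measureReal_mono fun ω hω hx => ?_)
    exact abs_le_sqrt_of_sq_le (one_sub_empCorr_nonneg hx _ _) ((HG r).lam2_pos hθ hL hB) hO1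
      hexp (hω hx _ _)
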